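/- **Theorem 7.8 ($m(\varphi)$-normal concentration).** *Setting.* Let $(M,g)$ be a complete connected Riemannian manifold without boundary of dimension $n\ge 2$, with Riemannian distance $d_g$ and volume $\mathrm{vol}_g$, and let $\omega=e^{-f}\mathrm{vol}_g$ with $f\in C^\infty(M)$. Let $\varphi:(0,\infty)\to(0,\infty)$ be continuous and non-decreasing, and put $$\ln_\varphi(t)=\int_1^t\frac{ds}{\varphi(s)}\ (t>0),\qquad l_\varphi=\inf_{t>0}\ln_\varphi(t),\qquad L_\varphi=\sup_{t>0}\ln_\varphi(t),\qquad u_\varphi(r)=\int_0^r\ln_\varphi(t)\,dt .$$ Let $\exp_\varphi:\mathbb R\to[0,\infty]$ be the inverse of $\ln_\varphi$ on $(l_\varphi,L_\varphi)$, equal to $0$ on $\{\tau\le l_\varphi\}$ and to $\infty$ on $\{\tau\ge L_\varphi\}$. Let $h_\varphi(r)=u_\varphi(r)$ if $L_\varphi=\infty$ and $h_\varphi(r)=u_\varphi(r)-rL_\varphi$ if $L_\varphi<\infty$; let $h_\varphi'(0)=\lim_{r\downarrow0}h'_\varphi(r)$ and $h_\varphi'(\infty)=\lim_{r\to\infty}h_\varphi'(r)$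 (which is $\infty$ if $L_\varphi=\infty$ and $0$ if $L_\varphi<\infty$). Let $\theta_\varphi$ and $\delta_\varphi$ be the supremum and the infimum over $s>0$ of $$\frac{s}{\varphi(s)}\limsup_{t\downarrow0}\frac{\varphi(s+t)-\varphi(s)}{t}.$$ For $m\ne1$ let $e_m(\tau)=[1+(m-1)\tau]_+^{1/(m-1)}$, with $0^a=\infty$ for $a<0$, and let $e_1=\exp$. Let $\Psi\in C(M)$, $\sigma=\exp_\varphi(-\Psi)$, $\nu=\sigma\omega$ and $M_\varphi^\Psi=\Psi^{-1}((-L_\varphi,-l_\varphi))$. The quadruple $(M,\omega,\varphi,\Psi)$ is *admissible* if $\varphi(1)=1$; $\theta_\varphi\le\frac{n+1}{n}$ and $\theta_\varphi<\frac32$; $\Psi>-L$ on $M$, where $L=\frac1{\theta_\varphi-1}$ if $\theta_\varphi>1$ and $L=\infty$ otherwise; $M_\varphi^\Psi\neq\emptyset$; and $h_\varphi(\sigma),\ \sigma\ln_\varphi(\sigma)\in L^1(M,\omega)$. For a Borel probability measure $\mu$ with Lebesgue decomposition $\mu=\rho\,\omega+\mu^s$ let $$H_\varphi(\mu)=\int_M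 h_\varphi(\rho)\,d\omega-\int_M h'_\varphi(\sigma)\,d\mu+h'_\varphi(\infty)\,\mu^s[M]$$ (with $\infty\cdot0=0$) if $h_\varphi(\rho)\in L^1(M,\omega)$ and $h'_\varphi(\sigma)\in L^1(M,\mu)$, and $H_\varphi(\mu)=\infty$ otherwise. Let $(\mathcal P^2(M),W_2)$ be the $L^2$-Wasserstein space over $(M,d_g)$. The condition $\operatorname{Hess}H_\varphi\ge K$ means: any $\mu_0,\mu_1\in\mathcal P^2(M)$ with $\mu_0[M_\varphi^\Psi]=\mu_1[M_\varphi^\Psi]=1$ are joined by a minimal geodesic $(\mu_t)_{t\in[0,1]}$ of $(\mathcal P^2(M),W_2)$ such that, for all $t\in[0,1]$, $$H_\varphi(\mu_t)\le(1-t)H_\varphi(\mu_0)+tH_\varphi(\mu_1)-\frac K2(1-t)t\,W_2(\mu_0,\mu_1)^2 .$$ For $r>0$ let $$\alpha(r)=\sup\{\,1-\nu[B(A,r)]\ :\ A\subset M\text{ measurable},\ \nu[A]\ge\tfrac12\,\},\qquad B(A,r)=\{y\in M:\inf_{x\in A}d_g(x,y)<r\},$$ and $\alpha(r)^{-1}=\infty$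 if $\alpha(r)=0$. *Statement.* Assume that $(M,\omega,\varphi,\Psi)$ is admissible, that $\nu$ is a probability measure, that $\operatorname{Hess}H_\varphi\ge K$ for some $K>0$, and that $\|\sigma\|_\infty=\|\sigma\|_{L^\infty(M,\omega)}<\infty$. Fix any $\xi_0\ge\max\{1,\|\sigma\|_\infty\}$ and write $\theta=\theta_\varphi$, $\delta=\delta_\varphi$. (i) If $\theta<1$ and $\delta>0$, then for all $r>0$ $$\alpha(r)^{-1}\ \ge\ \left\{\frac{\delta(1-\theta)}{(1-\delta)(2-\delta)}\right\}^{1/(1-\delta)} e_{2-\delta}\!\left(\frac K4\,\xi_0^{\delta-1}r^2\right).$$ (ii) If $\theta\in(1,3/2)$, $\delta>3(\theta-1)$ and $\omega[M]<\infty$, then for all $r>0$ $$\alpha(r)\ \le\ \left\{\frac{(\theta-1)(3-3\theta+\delta)}{2\theta-\delta-1}\right\}^{1/(1-2\theta+\delta)} e_{2(1-\theta)+\delta}\!\left(-\frac K2\,\frac{\theta-1}{(2-\theta)(3\theta-\delta-2)}\,\xi_0^{\delta-\theta}\,\omega[M]^{1-\theta}\,r^2\right).$$ (iii) If $\theta=1$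 and $\delta>1/2$, then for all $r>0$ $$\alpha(r)^{-1}\ \ge\ e_{3-2\delta}\!\left(\frac{-2}{3-2\delta}\right) e_{3-2\delta}\!\left(\frac K4\,\xi_0^{\delta-1}r^2\right).$$ -/

import Mathlib

open Set Filter MeasureTheory
open scoped ENNReal Topology Manifold Bundle

noncomputable section

/-! ### Deformed logarithms and exponentials -/

/-- The standing assumptions on the deformation function `φ : (0,∞) → (0,∞)`
(values outside `(0,∞)` are irrelevant). -/
structure IsDeformation (φ : ℝ → ℝ) : Prop where
  continuousOn : ContinuousOn φ (Ioi 0)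
  monotoneOn : MonotoneOn φ (Ioi 0)
  pos : ∀ s, 0 < s → 0 < φ s

/-- `ln_φ(t) = ∫_1^t ds / φ(s)` for `t > 0`. -/
def phiLog (φ : ℝ → ℝ) (t : ℝ) : ℝ := ∫ s in (1 : ℝ)..t, 1 / φ s

/-- `l_φ = inf_{t>0} ln_φ(t)`, an extended real. -/
def phiLogInf (φ : ℝ → ℝ) : EReal := ⨅ t ∈ Ioi (0 : ℝ), (phiLog φ t : EReal)

/-- `L_φ = sup_{t>0} ln_φ(t)`, an extended real. -/
def phiLogSup (φ : ℝ → ℝ) : EReal := ⨆ t ∈ Ioi (0 : ℝ), (phiLog φ t : EReal)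

open Classical in
/-- `exp_φ : ℝ → [0,∞]`: the inverse of `ln_φ` on `(l_φ, L_φ)`, equal to `0` below and
to `∞` above this interval. -/
def phiExp (φ : ℝ → ℝ) (τ : ℝ) : ℝ≥0∞ :=
  if (τ : EReal) ≤ phiLogInf φ then 0
  else if phiLogSup φ ≤ (τ : EReal) then ⊤
  else ENNReal.ofReal (Function.invFunOn (phiLog φ) (Ioi 0) τ)

/-- The power function `φ_m(s) = s^(2-m)`. -/
def powerDeformation (m : ℝ) (s : ℝ) : ℝ := s ^ (2 - m)

open Classical in
/-- The `m`-exponential `e_m(τ) = [1 + (m-1)τ]_+^{1/(m-1)}` for `m ≠ 1`, where `0^a = ∞` for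
`a < 0`, and `e_1 = exp`. -/
def mExp (m τ : ℝ) : ℝ≥0∞ :=
  if m = 1 then ENNReal.ofReal (Real.exp τ)
  else ENNReal.ofReal (1 + (m - 1) * τ) ^ (1 / (m - 1))

/-- `(s / φ(s)) · limsup_{t ↓ 0} (φ(s+t) - φ(s)) / t ∈ [0,∞]`, for non-decreasing `φ`. -/
def orderAt (φ : ℝ → ℝ) (s : ℝ) : ℝ≥0∞ :=
  ENNReal.ofReal (s / φ s) *
    limsup (fun t : ℝ => ENNReal.ofReal ((φ (s + t) - φ s) / t)) (𝓝[>] 0)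

/-- The upper order `θ_φ ∈ [0,∞]`. -/
def upperOrder (φ : ℝ → ℝ) : ℝ≥0∞ := ⨆ s ∈ Ioi (0 : ℝ), orderAt φ s

/-- The lower order `δ_φ`. -/
def lowerOrder (φ : ℝ → ℝ) : ℝ≥0∞ := ⨅ s ∈ Ioi (0 : ℝ), orderAt φ s

/-- `u_φ(r) = ∫_0^r ln_φ(t) dt`. -/
def phiU (φ : ℝ → ℝ) (r : ℝ) : ℝ := ∫ t in (0 : ℝ)..r, phiLog φ t

open Classical in
/-- `L_φ` if it is finite, and `0` if `L_φ = ∞`. -/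
def phiShift (φ : ℝ → ℝ) : ℝ := if phiLogSup φ = ⊤ then 0 else (phiLogSup φ).toReal

/-- `h_φ(r) = u_φ(r)` if `L_φ = ∞` and `h_φ(r) = u_φ(r) - r L_φ` if `L_φ < ∞`. -/
def phiH (φ : ℝ → ℝ) (r : ℝ) : ℝ := phiU φ r - r * phiShift φ

open Classical in
/-- The derivative `h_φ'(r)`, extended to `r = 0` by its limit `l_φ` (resp. `l_φ - L_φ`).
The value at `0` is only used when `l_φ > -∞`. -/
def phiHDeriv (φ : ℝ → ℝ) (r : ℝ) : ℝ :=
  (if r = 0 then (phiLogInf φ).toReal else phiLog φ r) - phiShift φ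

open Classical in
/-- `h_φ'(∞) = lim_{r → ∞} h_φ'(r)`, which is `∞` if `L_φ = ∞` and `0` if `L_φ < ∞`. -/
def phiHDerivTop (φ : ℝ → ℝ) : EReal := if phiLogSup φ = ⊤ then ⊤ else 0

/-! ### Wasserstein geometry -/

/-- `q` is a coupling of `μ` and `ν`. -/
def IsCouplingOf {M : Type*} [MeasurableSpace M] (q : Measure (M × M)) (μ ν : Measure M) : Prop :=
  q.map Prod.fst = μ ∧ q.map Prod.snd = ν

/-- The Borel probability measures with finite second moment. -/
def MemP2 {M : Type*} [MetricSpace M] [MeasurableSpace M] (μ : Measure M) : Prop :=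
  IsProbabilityMeasure μ ∧ ∃ x₀ : M, ∫⁻ x, edist x₀ x ^ 2 ∂μ < ⊤

/-- The `L²`-Wasserstein distance. -/
def wassersteinTwo {M : Type*} [MetricSpace M] [MeasurableSpace M] (μ ν : Measure M) : ℝ≥0∞ :=
  ⨅ (q : Measure (M × M)) (_ : IsCouplingOf q μ ν),
    (∫⁻ z, edist z.1 z.2 ^ 2 ∂q) ^ (1 / 2 : ℝ)

/-- `γ : [0,1] → P²(M)` is a minimal geodesic of the `L²`-Wasserstein space. -/
def IsWassersteinGeodesic {M : Type*} [MetricSpace M] [MeasurableSpace M]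
    (γ : ℝ → Measure M) : Prop :=
  (∀ t ∈ Icc (0 : ℝ) 1, MemP2 (γ t)) ∧
    ∀ s ∈ Icc (0 : ℝ) 1, ∀ t ∈ Icc (0 : ℝ) 1,
      wassersteinTwo (γ s) (γ t) = ENNReal.ofReal |s - t| * wassersteinTwo (γ 0) (γ 1)

/-! ### The reference measure, the `φ`-relative entropy and admissibility -/

/-- The weighted Riemannian measure `ω = e^{-f} vol_g` of an `n`-dimensional Riemannian manifold.
The Riemannian volume measure `vol_g` is the `n`-dimensional Hausdorff measure of the Riemannian
distance, normalized so as to agree with the Lebesgue measure on Euclidean `n`-space. -/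
def weightedVolume {M : Type*} [MetricSpace M] [MeasurableSpace M] [BorelSpace M]
    (n : ℕ) (f : M → ℝ) : Measure M :=
  (μHE[n] : Measure M).withDensity fun x => ENNReal.ofReal (Real.exp (-f x))

/-- The density `σ = exp_φ(-Ψ)`; it is finite where `Ψ > -L_φ`. -/
def refDensity {M : Type*} (φ : ℝ → ℝ) (Ψ : M → ℝ) (x : M) : ℝ := (phiExp φ (-Ψ x)).toReal

/-- The reference measure `ν = σ ω = exp_φ(-Ψ) ω`. -/
def refMeasure {M : Type*} [MeasurableSpace M] (ω : Measure M) (φ : ℝ → ℝ) (Ψ : M → ℝ) :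
    Measure M :=
  ω.withDensity fun x => phiExp φ (-Ψ x)

/-- The set `M_φ^Ψ = Ψ⁻¹((-L_φ, -l_φ))`. -/
def refSupport {M : Type*} (φ : ℝ → ℝ) (Ψ : M → ℝ) : Set M :=
  {x | -phiLogSup φ < (Ψ x : EReal) ∧ (Ψ x : EReal) < -phiLogInf φ}

/-- Admissibility of the quadruple `(M, ω, φ, Ψ)`, where `n` is the dimension of `M`. -/
structure IsAdmissible {M : Type*} [MeasurableSpace M]
    (n : ℕ) (ω : Measure M) (φ : ℝ → ℝ) (Ψ : M → ℝ) : Prop where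
  normalized : φ 1 = 1
  upperOrder_le : upperOrder φ ≤ ((n : ℝ≥0∞) + 1) / n
  upperOrder_lt : upperOrder φ < 3 / 2
  potential_gt : ∀ x, -phiLogSup (powerDeformation (2 - (upperOrder φ).toReal)) < (Ψ x : EReal)
  support_nonempty : (refSupport φ Ψ).Nonempty
  integrable_h : Integrable (fun x => phiH φ (refDensity φ Ψ x)) ω
  integrable_log : Integrable (fun x => refDensity φ Ψ x * phiLog φ (refDensity φ Ψ x)) ω

open Classical in
/-- The `φ`-relative entropy: with the Lebesgue decomposition `μ = ρ ω + μ^s`,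
`H_φ(μ) = ∫ h_φ(ρ) dω - ∫ h_φ'(σ) dμ + h_φ'(∞) μ^s[M]` if `h_φ(ρ) ∈ L¹(ω)` and
`h_φ'(σ) ∈ L¹(μ)`, and `H_φ(μ) = ∞` otherwise. -/
def relEntropy {M : Type*} [MeasurableSpace M] (ω : Measure M) (φ : ℝ → ℝ) (Ψ : M → ℝ)
    (μ : Measure M) : EReal :=
  if Integrable (fun x => phiH φ (μ.rnDeriv ω x).toReal) ω ∧
      Integrable (fun x => phiHDeriv φ (refDensity φ Ψ x)) μ then
    ((∫ x, phiH φ (μ.rnDeriv ω x).toReal ∂ω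
        - ∫ x, phiHDeriv φ (refDensity φ Ψ x) ∂μ : ℝ) : EReal)
      + phiHDerivTop φ * (μ.singularPart ω univ : EReal)
  else ⊤

/-- `Hess H_φ ≥ K`: weak `K`-convexity of `H_φ` in the `L²`-Wasserstein space. Any two measures of
`P²(M)` concentrated on `M_φ^Ψ` are joined by a minimal geodesic of `P²(M)` along which the
`K`-convexity inequality holds. No convexity is required along geodesics from or to measures that
charge the complement of `M_φ^Ψ`, where `h_φ'(σ)` is constant. -/
def HessEntropyGE {M : Type*} [MetricSpace M] [MeasurableSpace M]
    (ω : Measure M) (φ : ℝ → ℝ) (Ψ : M → ℝ) (K : ℝ) : Prop :=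
  ∀ μ₀ μ₁ : Measure M, MemP2 μ₀ → MemP2 μ₁ →
    μ₀ (refSupport φ Ψ)ᶜ = 0 → μ₁ (refSupport φ Ψ)ᶜ = 0 →
    ∃ γ : ℝ → Measure M, γ 0 = μ₀ ∧ γ 1 = μ₁ ∧ IsWassersteinGeodesic γ ∧
      ∀ t ∈ Icc (0 : ℝ) 1,
        relEntropy ω φ Ψ (γ t) ≤
          ((1 - t : ℝ) : EReal) * relEntropy ω φ Ψ μ₀ + (t : EReal) * relEntropy ω φ Ψ μ₁
            - ((K / 2 * (1 - t) * t * (wassersteinTwo μ₀ μ₁).toReal ^ 2 : ℝ) : EReal)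

/-- The concentration function
`α(r) = sup {1 - ν[B(A,r)] | A measurable, ν[A] ≥ 1/2}`. -/
def concentrationFunction {M : Type*} [MetricSpace M] [MeasurableSpace M]
    (ν : Measure M) (r : ℝ) : ℝ≥0∞ :=
  ⨆ (A : Set M) (_ : MeasurableSet A) (_ : 1 / 2 ≤ ν A), 1 - ν (Metric.thickening r A)

end

/-! Let `A` have mass at least 1/2, let `B` be the complement of its `r`-neighbourhood, and let a, b
be their ν-masses. Condition ν to `A` and to `B`. A coupling of the two conditionings moves all mass
by at least `r`, so their Wasserstein distance is at least `r`. The tangent inequality for the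
convex function h_φ at σ shows that no probability measure has entropy below E = ∫ (h_φ(σ) - σ
h_φ'(σ)) dω. Comparing E with the entropy at the midpoint of a geodesic, K-convexity gives (K/4) r²
≤ (H(ν_A) - E) + (H(ν_B) - E).

Each excess is the integral of the Bregman divergence of h_φ from σ to the conditioned density,
which is cσ with c = 1/a on `A` and 0 elsewhere (likewise for `B`). Now h_φ'' = 1/φ, and the orders
say v^δ φ(s) ≤ φ(vs) ≤ v^θ φ(s) for v ≥ 1 (`hasPowerGrowth_orders`). Hence the divergence is at most
σ²/φ(σ) times ∫_1^c (c - v) v^(-δ) dv on the set, and σ²/φ(σ) times 1/(2 - θ) off it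
(`IsTameDeformation.bregman_le_of_growth`, `IsTameReference.exists_relEntropy_cond_eq`). From φ(1) =
1 and σ ≤ ξ₀ follows σ²/φ(σ) ≤ ξ₀^(θ-δ) σ^(2-θ). The integral of the right side is controlled by
ν-mass: for θ ≤ 1 by bounding σ^(1-θ) once more by ξ₀^(1-θ), for θ > 1 by Hölder and ω[M] < ∞.

What is left (`IsTameReference.mul_sq_le`) is an inequality between r², a and b. Since a ≥ 1/2, the
terms in a are bounded, and the growing term is a negative power of b, or log(1/b) when δ = θ = 1.
Elementary estimates put it in the form C · D ≤ b^(-p), or its exponential analogue, which is solved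
for b. -/

noncomputable section

/-! ### σ-finiteness of the weighted Riemannian volume -/

section SigmaFinite

open Metric Manifold
open scoped NNReal ContDiff

attribute [local instance] normedAddCommGroupTangentSpaceVectorSpace
attribute [local instance] normedSpaceTangentSpaceVectorSpace

set_option maxHeartbeats 1000000 in
/-- The inverse of an extended chart is Lipschitz near the base point, uniformly in pairs of
points. -/
theorem exists_nhds_edist_le_edist_extChartAt {E : Type*} [NormedAddCommGroup E]
    [NormedSpace ℝ E] {H : Type*} [TopologicalSpace H] (I : ModelWithCorners ℝ E H)
    {M : Type*} [TopologicalSpace M] [ChartedSpace H M]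
    [Bundle.RiemannianBundle (fun x : M => TangentSpace I x)]
    [IsManifold I 1 M] [IsContinuousRiemannianBundle E (fun x : M => TangentSpace I x)]
    (x : M) :
    ∃ C : ℝ≥0, ∃ U ∈ 𝓝 x, ∃ r > 0,
      (∀ y ∈ U, y ∈ (extChartAt I x).source ∧ extChartAt I x y ∈ ball (extChartAt I x x) r) ∧
      ∀ y ∈ U, ∀ z ∈ U,
        riemannianEDist I y z ≤ C * edist (extChartAt I x y) (extChartAt I x z) := by
  rcases eventually_enorm_mfderivWithin_symm_extChartAt_lt I x with ⟨C, C_pos, hC⟩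
  obtain ⟨r, r_pos, hr⟩ := mem_nhdsWithin_iff.1
    (inter_mem (extChartAt_target_mem_nhdsWithin (I := I) x) hC)
  have A : (extChartAt I x) ⁻¹' (ball (extChartAt I x x) r ∩ range I) ∈ 𝓝 x := by
    apply extChartAt_preimage_mem_nhds_of_mem_nhdsWithin (by simp)
    rw [inter_comm]
    exact inter_mem_nhdsWithin _ (ball_mem_nhds _ r_pos)
  refine ⟨C, _, inter_mem A (extChartAt_source_mem_nhds (I := I) x), r, r_pos,
    fun y hy => ⟨hy.2, hy.1.1⟩, ?_⟩
  rintro y ⟨hy, h'y⟩ z ⟨hz, h'z⟩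
  -- The comparison path is the chart segment from `y` to `z`. Ball and model range are convex, so
  -- it stays where the derivative of the inverse chart has norm at most `C`.
  let η := ContinuousAffineMap.lineMap (R := ℝ) (extChartAt I x y) (extChartAt I x z)
  set γ := (extChartAt I x).symm ∘ η
  have hseg : η '' Icc 0 1 ⊆ ball (extChartAt I x x) r ∩ range I := by
    simp only [ContinuousAffineMap.coe_lineMap_eq, ← segment_eq_image_lineMap, η]
    exact ((convex_ball _ _).inter I.convex_range).segment_subset hy hz
  have hη := image_subset_iff.1 (hseg.trans hr)
  simp only [preimage_inter, subset_inter_iff] at hη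
  have η_smooth : ContMDiffOn 𝓘(ℝ, ℝ) 𝓘(ℝ, E) 1 η (Icc 0 1) := by
    apply ContMDiff.contMDiffOn
    rw [contMDiff_iff_contDiff]
    exact ContinuousAffineMap.contDiff _
  have : riemannianEDist I y z ≤ pathELength I γ 0 1 := by
    apply riemannianEDist_le_pathELength _ _ _ zero_le_one
    · exact (contMDiffOn_extChartAt_symm x).comp η_smooth hη.1
    · simp [γ, η, ContinuousAffineMap.coe_lineMap_eq, (chartAt H x).left_inv (extChartAt_source I x ▸ h'y)]
    · simp [γ, η, ContinuousAffineMap.coe_lineMap_eq, (chartAt H x).left_inv (extChartAt_source I x ▸ h'z)]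
  apply this.trans
  rw [← lintegral_fderiv_lineMap_eq_edist, pathELength_eq_lintegral_mfderivWithin_Icc,
    ← lintegral_const_mul' _ _ ENNReal.coe_ne_top]
  apply setLIntegral_mono' measurableSet_Icc (fun t ht ↦ ?_)
  have : mfderivWithin 𝓘(ℝ, ℝ) I γ (Icc 0 1) t =
      (mfderivWithin 𝓘(ℝ, E) I (extChartAt I x).symm (range I) (η t)) ∘L
        (mfderivWithin 𝓘(ℝ, ℝ) 𝓘(ℝ, E) η (Icc 0 1) t) := by
    apply mfderivWithin_comp
    · exact mdifferentiableWithinAt_extChartAt_symm (hη.1 ht)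
    · exact η_smooth.mdifferentiableOn one_ne_zero t ht
    · exact hη.1.trans (preimage_mono (extChartAt_target_subset_range x))
    · rw [uniqueMDiffWithinAt_iff_uniqueDiffWithinAt]
      exact uniqueDiffOn_Icc zero_lt_one t ht
  have : mfderivWithin 𝓘(ℝ, ℝ) I γ (Icc 0 1) t 1 =
      (mfderivWithin 𝓘(ℝ, E) I (extChartAt I x).symm (range I) (η t))
        (mfderivWithin 𝓘(ℝ, ℝ) 𝓘(ℝ, E) η (Icc 0 1) t 1) := congr($this 1)
  rw [this]
  apply (ContinuousLinearMap.le_opENorm _ _).trans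
  gcongr
  · exact (hη.2 ht).le
  · simp only [mfderivWithin_eq_fderivWithin]
    exact le_of_eq rfl

end SigmaFinite

/-- A small neighbourhood is the image of part of a Euclidean ball under a Lipschitz inverse chart,
and Lipschitz maps increase Hausdorff measure by at most a finite factor. On the model space
Hausdorff measure is Haar, so balls have finite measure. -/
theorem isLocallyFiniteMeasure_euclideanHausdorffMeasure {n : ℕ} {M : Type*} [MetricSpace M]
    [ChartedSpace (EuclideanSpace ℝ (Fin n)) M] [IsManifold (𝓡 n) 1 M]
    [Bundle.RiemannianBundle (fun x : M => TangentSpace (𝓡 n) x)]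
    [IsContinuousRiemannianBundle (EuclideanSpace ℝ (Fin n))
      (fun x : M => TangentSpace (𝓡 n) x)]
    [IsRiemannianManifold (𝓡 n) M] [MeasurableSpace M] [BorelSpace M] :
    IsLocallyFiniteMeasure (μHE[n] : Measure M) := by
  refine ⟨fun x => ?_⟩
  obtain ⟨C, U, hU, r, hr, hball, hC⟩ := exists_nhds_edist_le_edist_extChartAt (𝓡 n) x
  refine ⟨U, hU, ?_⟩
  set e := extChartAt (𝓡 n) x
  have hlip : LipschitzOnWith C e.symm (e '' U) := by
    rintro _ ⟨y, hy, rfl⟩ _ ⟨z, hz, rfl⟩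
    rw [e.left_inv (hball y hy).1, e.left_inv (hball z hz).1,
      IsRiemannianManifold.out (I := 𝓡 n) y z]
    exact hC y hy z hz
  have himg : e.symm '' (e '' U) = U := by
    rw [image_image]
    exact (image_congr fun y hy => e.left_inv (hball y hy).1).trans (image_id' U)
  have h1 := hlip.hausdorffMeasure_image_le (d := (n : ℝ)) (Nat.cast_nonneg n)
  rw [himg] at h1
  have h2 : μH[(n : ℝ)] (e '' U) < ⊤ := by
    refine (measure_mono (t := Metric.ball (e x) r) ?_).trans_lt ?_
    · rintro _ ⟨y, hy, rfl⟩
      exact (hball y hy).2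
    · have : (μH[(n : ℝ)] : Measure (EuclideanSpace ℝ (Fin n))).IsAddHaarMeasure := by
        have := isAddHaarMeasure_hausdorffMeasure (E := EuclideanSpace ℝ (Fin n))
        rwa [finrank_euclideanSpace_fin] at this
      exact measure_ball_lt_top
  have h3 : μH[(n : ℝ)] U < ⊤ :=
    h1.trans_lt (ENNReal.mul_lt_top (ENNReal.rpow_lt_top_of_nonneg (Nat.cast_nonneg n) (by simp)) h2)
  rw [Measure.euclideanHausdorffMeasure_def]
  exact ENNReal.mul_lt_top (by simp) h3

/-- Needed for Lebesgue decompositions with respect to ω, on which the relative entropy rests. -/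
theorem sigmaFinite_weightedVolume {n : ℕ} {M : Type*} [MetricSpace M]
    [ChartedSpace (EuclideanSpace ℝ (Fin n)) M] [IsManifold (𝓡 n) 1 M]
    [Bundle.RiemannianBundle (fun x : M => TangentSpace (𝓡 n) x)]
    [IsContinuousRiemannianBundle (EuclideanSpace ℝ (Fin n))
      (fun x : M => TangentSpace (𝓡 n) x)]
    [IsRiemannianManifold (𝓡 n) M] [SecondCountableTopology M] [MeasurableSpace M] [BorelSpace M]
    (f : M → ℝ) : SigmaFinite (weightedVolume n f) := by
  have := isLocallyFiniteMeasure_euclideanHausdorffMeasure (n := n) (M := M)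
  exact SigmaFinite.withDensity_ofReal _

/-! ### Growth of deformations -/

/-- Two-sided power growth bounds: `c ^ δ φ(s) ≤ φ(c s) ≤ c ^ θ φ(s)` for `c ≥ 1`. -/
structure HasPowerGrowth (φ : ℝ → ℝ) (δ θ : ℝ) : Prop where
  lower : ∀ s, 0 < s → ∀ c, 1 ≤ c → c ^ δ * φ s ≤ φ (c * s)
  upper : ∀ s, 0 < s → ∀ c, 1 ≤ c → φ (c * s) ≤ c ^ θ * φ s

/-- Compare φ with the barrier (x/s)^(θ+ε) φ(s), which solves B' = (θ+ε) B/x with the same value at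
s. The ε makes the derivative inequality strict wherever φ touches the barrier; then ε → 0. -/
theorem upper_growth_of_dini {φ : ℝ → ℝ} (hφ : IsDeformation φ) {θ : ℝ}
    (h : ∀ x, 0 < x → ∀ r, θ * φ x / x < r → ∃ᶠ z in 𝓝[>] x, slope φ x z < r)
    {s c : ℝ} (hs : 0 < s) (hc : 1 ≤ c) : φ (c * s) ≤ c ^ θ * φ s := by
  have hcpos : 0 < c := by linarith
  have key : ∀ ε, 0 < ε → φ (c * s) ≤ c ^ (θ + ε) * φ s := by
    intro ε hε
    have hsc : s ≤ c * s := by nlinarith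
    have hsub : Icc s (c * s) ⊆ Ioi 0 := fun x hx => lt_of_lt_of_le hs hx.1
    have hB : ∀ x, 0 < x → HasDerivAt (fun x : ℝ => (x / s) ^ (θ + ε) * φ s)
        ((θ + ε) * ((x / s) ^ (θ + ε) * φ s) / x) x := by
      intro x hx
      have h1 := (((hasDerivAt_id x).div_const s).rpow_const (p := θ + ε)
        (Or.inl (div_pos hx hs).ne')).mul_const (φ s)
      convert! h1 using 1
      simp only [id]
      rw [Real.rpow_sub_one (div_pos hx hs).ne']
      field_simp
    have := image_le_of_liminf_slope_right_lt_deriv_boundary' (f := φ)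
      (f' := fun x => θ * φ x / x) (a := s) (b := c * s) (hφ.continuousOn.mono hsub)
      (fun x hx r hr => h x (hsub (Ico_subset_Icc_self hx)) r hr)
      (B := fun x => (x / s) ^ (θ + ε) * φ s)
      (B' := fun x => (θ + ε) * ((x / s) ^ (θ + ε) * φ s) / x)
      (by simp [div_self hs.ne'])
      (fun x hx => (hB x (hsub hx)).continuousAt.continuousWithinAt)
      (fun x hx => (hB x (hsub (Ico_subset_Icc_self hx))).hasDerivWithinAt)
      (by
        intro x hx hxe
        have hx0 : 0 < x := hsub (Ico_subset_Icc_self hx)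
        rw [← hxe]
        have := hφ.pos x hx0
        gcongr
        linarith) (right_mem_Icc.2 hsc)
    simpa [mul_div_assoc, div_self hs.ne'] using this
  have hlim : Tendsto (fun ε : ℝ => c ^ (θ + ε) * φ s) (𝓝[>] 0) (𝓝 (c ^ (θ + 0) * φ s)) := by
    apply Tendsto.mono_left _ nhdsWithin_le_nhds
    exact ((continuous_const.rpow (continuous_const.add continuous_id)
      (fun _ => Or.inl hcpos.ne')).mul continuous_const).tendsto 0
  rw [add_zero] at hlim
  exact ge_of_tendsto hlim (eventually_nhdsWithin_of_forall key)

/-- The same barrier argument for -φ, with exponent δ - ε. Slopes of φ that are large only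
frequently suffice, which is what a lower bound on a limsup provides. -/
theorem lower_growth_of_dini {φ : ℝ → ℝ} (hφ : IsDeformation φ) {δ : ℝ}
    (h : ∀ x, 0 < x → ∀ r, r < δ * φ x / x → ∃ᶠ z in 𝓝[>] x, r < slope φ x z)
    {s c : ℝ} (hs : 0 < s) (hc : 1 ≤ c) : c ^ δ * φ s ≤ φ (c * s) := by
  have hcpos : 0 < c := by linarith
  have key : ∀ ε, 0 < ε → c ^ (δ - ε) * φ s ≤ φ (c * s) := by
    intro ε hε
    have hsc : s ≤ c * s := by nlinarith
    have hsub : Icc s (c * s) ⊆ Ioi 0 := fun x hx => lt_of_lt_of_le hs hx.1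
    have hB : ∀ x, 0 < x → HasDerivAt (fun x : ℝ => -((x / s) ^ (δ - ε) * φ s))
        (-((δ - ε) * ((x / s) ^ (δ - ε) * φ s) / x)) x := by
      intro x hx
      have h1 := ((((hasDerivAt_id x).div_const s).rpow_const (p := δ - ε)
        (Or.inl (div_pos hx hs).ne')).mul_const (φ s)).neg
      convert! h1 using 1
      simp only [id]
      rw [Real.rpow_sub_one (div_pos hx hs).ne']
      field_simp
    have := image_le_of_liminf_slope_right_lt_deriv_boundary' (f := fun x => -φ x)
      (f' := fun x => -(δ * φ x / x)) (a := s) (b := c * s) (hφ.continuousOn.mono hsub).neg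
      (fun x hx r hr => by
        refine (h x (hsub (Ico_subset_Icc_self hx)) (-r) (by linarith)).mono fun z hz => ?_
        have : slope (fun x => -φ x) x z = - slope φ x z := by
          simp [slope_def_field]; ring
        rw [this]; linarith)
      (B := fun x => -((x / s) ^ (δ - ε) * φ s))
      (B' := fun x => -((δ - ε) * ((x / s) ^ (δ - ε) * φ s) / x))
      (by simp [div_self hs.ne'])
      (fun x hx => (hB x (hsub hx)).continuousAt.continuousWithinAt)
      (fun x hx => (hB x (hsub (Ico_subset_Icc_self hx))).hasDerivWithinAt)
      (by
        intro x hx hxe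
        have hx0 : 0 < x := hsub (Ico_subset_Icc_self hx)
        simp only [neg_inj] at hxe ⊢
        rw [← hxe]
        have := hφ.pos x hx0
        apply neg_lt_neg
        gcongr
        linarith) (right_mem_Icc.2 hsc)
    simp only [mul_div_assoc, div_self hs.ne', mul_one] at this
    linarith
  have hlim : Tendsto (fun ε : ℝ => c ^ (δ - ε) * φ s) (𝓝[>] 0) (𝓝 (c ^ (δ - 0) * φ s)) := by
    apply Tendsto.mono_left _ nhdsWithin_le_nhds
    exact ((continuous_const.rpow (continuous_const.sub continuous_id)
      (fun _ => Or.inl hcpos.ne')).mul continuous_const).tendsto 0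
  rw [sub_zero] at hlim
  exact le_of_tendsto hlim (eventually_nhdsWithin_of_forall key)

theorem slope_eq_add_div (φ : ℝ → ℝ) (x t : ℝ) : slope φ x (x + t) = (φ (x + t) - φ x) / t := by
  simp [slope_def_field]

theorem frequently_nhdsGT_of_add {p : ℝ → Prop} {x : ℝ}
    (h : ∃ᶠ t in 𝓝[>] (0 : ℝ), p (x + t)) : ∃ᶠ z in 𝓝[>] x, p z := by
  have : Tendsto (fun t : ℝ => x + t) (𝓝[>] 0) (𝓝[>] x) := by
    refine tendsto_nhdsWithin_iff.2 ⟨?_, eventually_nhdsWithin_of_forall fun t ht => ?_⟩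
    · have : Tendsto (fun t : ℝ => x + t) (𝓝 0) (𝓝 (x + 0)) :=
        (continuous_const.add continuous_id).tendsto 0
      rw [add_zero] at this
      exact this.mono_left nhdsWithin_le_nhds
    · simpa using ht
  exact this.frequently h

theorem limsup_eq_orderAt_mul {φ : ℝ → ℝ} (hφ : IsDeformation φ) {x : ℝ} (hx : 0 < x) :
    limsup (fun t : ℝ => ENNReal.ofReal ((φ (x + t) - φ x) / t)) (𝓝[>] 0)
      = ENNReal.ofReal (φ x / x) * orderAt φ x := by
  have hp := hφ.pos x hx
  rw [orderAt, ← mul_assoc, ← ENNReal.ofReal_mul (by positivity)]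
  rw [show φ x / x * (x / φ x) = 1 by field_simp]
  simp

/-- The orders bound the upper right Dini derivative of φ at x between δ φ(x)/x and θ φ(x)/x;
integrating these differential inequalities gives the power bounds. -/
theorem hasPowerGrowth_orders {φ : ℝ → ℝ} (hφ : IsDeformation φ) (hfin : upperOrder φ ≠ ⊤) :
    HasPowerGrowth φ (lowerOrder φ).toReal (upperOrder φ).toReal := by
  have hle : lowerOrder φ ≤ upperOrder φ :=
    (biInf_le (orderAt φ) (mem_Ioi.2 one_pos)).trans
      (le_biSup (orderAt φ) (mem_Ioi.2 (one_pos : (0 : ℝ) < 1)))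
  have hfin' : lowerOrder φ ≠ ⊤ := ne_top_of_le_ne_top hfin hle
  constructor
  · intro s hs c hc
    refine lower_growth_of_dini hφ (fun x hx r hr => ?_) hs hc
    have hp := hφ.pos x hx
    apply frequently_nhdsGT_of_add
    -- The order is built from `ENNReal.ofReal` of slopes and says nothing about negative `r`; there
    -- monotonicity of φ suffices.
    rcases lt_or_ge r 0 with hr0 | hr0
    · apply Eventually.frequently
      refine eventually_nhdsWithin_of_forall fun t ht => ?_
      rw [slope_eq_add_div]
      refine hr0.trans_le (div_nonneg (sub_nonneg.2 ?_) (le_of_lt ht))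
      exact hφ.monotoneOn hx (add_pos hx ht) (le_add_of_nonneg_right (le_of_lt ht))
    · have h1 : ENNReal.ofReal r <
          limsup (fun t : ℝ => ENNReal.ofReal ((φ (x + t) - φ x) / t)) (𝓝[>] 0) := by
        rw [limsup_eq_orderAt_mul hφ hx]
        have h2 : lowerOrder φ ≤ orderAt φ x := biInf_le (orderAt φ) hx
        refine lt_of_lt_of_le ?_ (mul_le_mul_right h2 _)
        rw [← ENNReal.ofReal_toReal hfin', ← ENNReal.ofReal_mul (by positivity)]
        refine (ENNReal.ofReal_lt_ofReal_iff_of_nonneg hr0).2 (hr.trans_eq (by ring))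
      refine (frequently_lt_of_lt_limsup (h := h1)).mono fun t ht => ?_
      rw [slope_eq_add_div]
      exact (ENNReal.ofReal_lt_ofReal_iff_of_nonneg hr0).1 ht
  · intro s hs c hc
    refine upper_growth_of_dini hφ (fun x hx r hr => ?_) hs hc
    have hp := hφ.pos x hx
    apply frequently_nhdsGT_of_add
    apply Eventually.frequently
    have hr0 : 0 < r := lt_of_le_of_lt (by positivity) hr
    have h1 : limsup (fun t : ℝ => ENNReal.ofReal ((φ (x + t) - φ x) / t)) (𝓝[>] 0)
        < ENNReal.ofReal r := by
      rw [limsup_eq_orderAt_mul hφ hx]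
      have h2 : orderAt φ x ≤ upperOrder φ := le_biSup (orderAt φ) hx
      refine lt_of_le_of_lt (mul_le_mul_right h2 _) ?_
      rw [← ENNReal.ofReal_toReal hfin, ← ENNReal.ofReal_mul (by positivity)]
      refine (ENNReal.ofReal_lt_ofReal_iff hr0).2 ((Eq.trans_lt (by ring) hr))
    filter_upwards [eventually_lt_of_limsup_lt h1] with t ht
    rw [slope_eq_add_div]
    exact (ENNReal.ofReal_lt_ofReal_iff hr0).1 ht

namespace HasPowerGrowth

variable {φ : ℝ → ℝ} {δ θ : ℝ}

/-- The growth bounds for ratios `c ≤ 1`. -/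
theorem le_of_le_one (h : HasPowerGrowth φ δ θ) {s c : ℝ} (hs : 0 < s) (hc : 0 < c)
    (hc1 : c ≤ 1) : c ^ θ * φ s ≤ φ (c * s) := by
  have h1 := h.upper (c * s) (by positivity) c⁻¹ ((one_le_inv₀ hc).2 hc1)
  rw [← mul_assoc, inv_mul_cancel₀ hc.ne', one_mul, Real.inv_rpow hc.le] at h1
  have h2 : 0 < c ^ θ := Real.rpow_pos_of_pos hc θ
  calc c ^ θ * φ s ≤ c ^ θ * ((c ^ θ)⁻¹ * φ (c * s)) := by gcongr
    _ = φ (c * s) := by field_simp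

theorem lower_le_upper (h : HasPowerGrowth φ δ θ) (hφ : IsDeformation φ) : δ ≤ θ := by
  have h1 := (h.lower 1 one_pos 2 one_le_two).trans (h.upper 1 one_pos 2 one_le_two)
  have h2 := le_of_mul_le_mul_right h1 (hφ.pos 1 one_pos)
  exact (Real.rpow_le_rpow_left_iff one_lt_two).1 h2

end HasPowerGrowth

/-! ### The deformed logarithm and its primitive -/

namespace IsDeformation

variable {φ : ℝ → ℝ}

theorem continuousOn_one_div (hφ : IsDeformation φ) : ContinuousOn (fun s => 1 / φ s) (Ioi 0) :=
  continuousOn_const.div hφ.continuousOn fun s hs => (hφ.pos s hs).ne'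

theorem intervalIntegrable_one_div (hφ : IsDeformation φ) {s t : ℝ} (hs : 0 < s) (ht : 0 < t) :
    IntervalIntegrable (fun s => 1 / φ s) volume s t :=
  (hφ.continuousOn_one_div.mono fun _ hx => (lt_min hs ht).trans_le hx.1).intervalIntegrable

theorem hasDerivAt_phiLog (hφ : IsDeformation φ) {t : ℝ} (ht : 0 < t) :
    HasDerivAt (phiLog φ) (1 / φ t) t :=
  intervalIntegral.integral_hasDerivAt_right (hφ.intervalIntegrable_one_div one_pos ht)
    (hφ.continuousOn_one_div.stronglyMeasurableAtFilter isOpen_Ioi t ht)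
    (hφ.continuousOn_one_div.continuousAt (Ioi_mem_nhds ht))

theorem continuousOn_phiLog (hφ : IsDeformation φ) : ContinuousOn (phiLog φ) (Ioi 0) :=
  fun _ ht => (hφ.hasDerivAt_phiLog ht).continuousAt.continuousWithinAt

theorem strictMonoOn_phiLog (hφ : IsDeformation φ) : StrictMonoOn (phiLog φ) (Ioi 0) := by
  refine strictMonoOn_of_deriv_pos (convex_Ioi 0) hφ.continuousOn_phiLog fun x hx => ?_
  rw [interior_Ioi] at hx
  rw [(hφ.hasDerivAt_phiLog hx).deriv]
  exact one_div_pos.2 (hφ.pos x hx)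

end IsDeformation

theorem phiLog_one (φ : ℝ → ℝ) : phiLog φ 1 = 0 := by simp [phiLog]

theorem phiU_zero (φ : ℝ → ℝ) : phiU φ 0 = 0 := by simp [phiU]

theorem phiH_zero (φ : ℝ → ℝ) : phiH φ 0 = 0 := by simp [phiH, phiU_zero]

/-- A deformation normalized at `1` with power growth, whose upper exponent is less than `3/2`, so
that the deformed logarithm is integrable at `0`. -/
structure IsTameDeformation (φ : ℝ → ℝ) (δ θ : ℝ) : Prop where
  isDeformation : IsDeformation φ
  growth : HasPowerGrowth φ δ θ
  normalized : φ 1 = 1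
  upper_lt : θ < 3 / 2

namespace IsTameDeformation

variable {φ : ℝ → ℝ} {δ θ : ℝ}

theorem rpow_le (h : IsTameDeformation φ δ θ) {t : ℝ} (ht : 0 < t) (ht1 : t ≤ 1) :
    t ^ θ ≤ φ t := by
  have := h.growth.le_of_le_one one_pos ht ht1
  rwa [h.normalized, mul_one, mul_one] at this

theorem le_rpow (h : IsTameDeformation φ δ θ) {t : ℝ} (ht : 1 ≤ t) : φ t ≤ t ^ θ := by
  have := h.growth.upper 1 one_pos t ht
  rwa [h.normalized, mul_one, mul_one] at this

theorem rpow_lower_le (h : IsTameDeformation φ δ θ) {t : ℝ} (ht : 1 ≤ t) : t ^ δ ≤ φ t := by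
  have := h.growth.lower 1 one_pos t ht
  rwa [h.normalized, mul_one, mul_one] at this

/-- On (0,1], φ(x) ≥ x^θ ≥ x^(3/2), so the derivative of ln_φ is at most x^(-3/2). The resulting
bound is integrable at 0, which makes u_φ a convergent integral. -/
theorem neg_rpow_le_phiLog (h : IsTameDeformation φ δ θ) {t : ℝ} (ht : 0 < t) (ht1 : t ≤ 1) :
    -(2 * t ^ (-(1 / 2) : ℝ)) ≤ phiLog φ t := by
  have hd : ∀ x ∈ Ioc (0 : ℝ) 1, HasDerivAt (fun x => phiLog φ x + 2 * x ^ (-(1 / 2) : ℝ))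
      (1 / φ x + 2 * (-(1 / 2) * x ^ (-(1 / 2) - 1 : ℝ))) x := fun x hx =>
    (h.isDeformation.hasDerivAt_phiLog hx.1).add
      ((Real.hasDerivAt_rpow_const (Or.inl hx.1.ne')).const_mul 2)
  have hanti : AntitoneOn (fun x => phiLog φ x + 2 * x ^ (-(1 / 2) : ℝ)) (Ioc 0 1) := by
    refine antitoneOn_of_deriv_nonpos (convex_Ioc 0 1)
      (fun x hx => (hd x hx).continuousAt.continuousWithinAt)
      (fun x hx => (hd x (interior_subset hx)).differentiableAt.differentiableWithinAt)
      fun x hx => ?_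
    have hx' := interior_subset hx
    rw [(hd x hx').deriv]
    have h1 : 1 / φ x ≤ x ^ (-(1 / 2) - 1 : ℝ) := by
      rw [one_div_le (h.isDeformation.pos x hx'.1) (Real.rpow_pos_of_pos hx'.1 _), one_div,
        ← Real.rpow_neg hx'.1.le]
      refine le_trans ?_ (h.rpow_le hx'.1 hx'.2)
      exact Real.rpow_le_rpow_of_exponent_ge hx'.1 hx'.2 (by have := h.upper_lt; linarith)
    linarith
  have := hanti ⟨ht, ht1⟩ (right_mem_Ioc.2 one_pos) ht1
  simp only [phiLog_one, Real.one_rpow] at this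
  linarith

theorem intervalIntegrable_phiLog (h : IsTameDeformation φ δ θ) {r : ℝ} (hr : 0 ≤ r) :
    IntervalIntegrable (phiLog φ) volume 0 r := by
  have h01 : IntervalIntegrable (phiLog φ) volume 0 1 := by
    rw [intervalIntegrable_iff_integrableOn_Ioc_of_le zero_le_one]
    have hi : IntegrableOn (fun t : ℝ => 2 * t ^ (-(1 / 2) : ℝ)) (Ioc 0 1) := by
      have := (intervalIntegral.intervalIntegrable_rpow' (a := 0) (b := 1)
        (r := (-(1 / 2) : ℝ)) (by norm_num)).const_mul 2
      rwa [intervalIntegrable_iff_integrableOn_Ioc_of_le zero_le_one] at this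
    refine Integrable.mono' hi ?_ ?_
    · exact (h.isDeformation.continuousOn_phiLog.mono fun x hx => hx.1).aestronglyMeasurable
        measurableSet_Ioc
    · refine (ae_restrict_iff' measurableSet_Ioc).2 (ae_of_all _ fun t ht => ?_)
      have h1 := h.neg_rpow_le_phiLog ht.1 ht.2
      have h2 := h.isDeformation.strictMonoOn_phiLog.monotoneOn ht.1 (mem_Ioi.2 one_pos) ht.2
      rw [phiLog_one] at h2
      rw [Real.norm_of_nonpos h2]
      linarith
  rcases hr.eq_or_lt with rfl | hr
  · exact IntervalIntegrable.refl
  · refine h01.trans (ContinuousOn.intervalIntegrable ?_)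
    exact h.isDeformation.continuousOn_phiLog.mono fun x hx => (lt_min one_pos hr).trans_le hx.1

theorem continuousOn_phiU (h : IsTameDeformation φ δ θ) : ContinuousOn (phiU φ) (Ici 0) := by
  intro x hx
  have hx : (0 : ℝ) ≤ x := hx
  have := intervalIntegral.continuousOn_primitive_interval' (a := 0)
    (h.intervalIntegrable_phiLog (r := x + 1) (by linarith)) left_mem_uIcc
  rw [uIcc_of_le (by linarith)] at this
  refine (this x ⟨hx, by linarith⟩).mono_of_mem_nhdsWithin ?_
  refine mem_of_superset (inter_mem self_mem_nhdsWithin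
    (mem_nhdsWithin_of_mem_nhds (Iio_mem_nhds (lt_add_one x)))) fun y hy => ⟨hy.1, le_of_lt hy.2⟩

theorem hasDerivAt_phiU (h : IsTameDeformation φ δ θ) {t : ℝ} (ht : 0 < t) :
    HasDerivAt (phiU φ) (phiLog φ t) t :=
  intervalIntegral.integral_hasDerivAt_right (h.intervalIntegrable_phiLog ht.le)
    (h.isDeformation.continuousOn_phiLog.stronglyMeasurableAtFilter isOpen_Ioi t ht)
    (h.isDeformation.continuousOn_phiLog.continuousAt (Ioi_mem_nhds ht))

theorem convexOn_phiU (h : IsTameDeformation φ δ θ) : ConvexOn ℝ (Ici 0) (phiU φ) := by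
  refine MonotoneOn.convexOn_of_deriv (convex_Ici 0) h.continuousOn_phiU ?_ ?_
  · rw [interior_Ici]
    exact fun x hx => (h.hasDerivAt_phiU hx).differentiableAt.differentiableWithinAt
  · rw [interior_Ici]
    intro x hx y hy hxy
    rw [(h.hasDerivAt_phiU hx).deriv, (h.hasDerivAt_phiU hy).deriv]
    exact h.isDeformation.strictMonoOn_phiLog.monotoneOn hx hy hxy

theorem tangent_le_phiU (h : IsTameDeformation φ δ θ) {s r : ℝ} (hs : 0 < s) (hr : 0 ≤ r) :
    phiU φ s + (r - s) * phiLog φ s ≤ phiU φ r := by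
  rcases lt_trichotomy r s with hrs | rfl | hrs
  · have := h.convexOn_phiU.slope_le_of_hasDerivAt hr hs.le hrs (h.hasDerivAt_phiU hs)
    rw [slope_def_field, div_le_iff₀ (by linarith)] at this
    linarith
  · simp
  · have := h.convexOn_phiU.le_slope_of_hasDerivAt hs.le hr hrs (h.hasDerivAt_phiU hs)
    rw [slope_def_field, le_div_iff₀ (by linarith)] at this
    linarith

end IsTameDeformation

/-! ### Bregman divergences of powers -/

open Classical in
/-- The function `c ↦ ∫_1^c (c - v) v^(-m) dv`. -/
def powerBregman (m c : ℝ) : ℝ :=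
  if m = 1 then c * Real.log c - c + 1
  else c ^ (2 - m) / ((1 - m) * (2 - m)) - c / (1 - m) + 1 / (2 - m)

open Classical in
/-- The function `c ↦ ∫_1^c v^(-m) dv`. -/
def powerBregmanDeriv (m c : ℝ) : ℝ :=
  if m = 1 then Real.log c else (c ^ (1 - m) - 1) / (1 - m)

theorem hasDerivAt_powerBregman {m c : ℝ} (hm : m < 2) (hc : 0 < c) :
    HasDerivAt (powerBregman m) (powerBregmanDeriv m c) c := by
  unfold powerBregman powerBregmanDeriv
  split_ifs with h1
  · convert! (((hasDerivAt_id c).mul (Real.hasDerivAt_log hc.ne')).sub (hasDerivAt_id c)).add_const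
      (1 : ℝ) using 1
    simp [hc.ne']
  · have h1' : 1 - m ≠ 0 := sub_ne_zero.2 (Ne.symm h1)
    have h2' : 2 - m ≠ 0 := by linarith
    convert! ((((Real.hasDerivAt_rpow_const (x := c) (p := 2 - m) (Or.inl hc.ne')).div_const
      ((1 - m) * (2 - m))).sub ((hasDerivAt_id c).div_const (1 - m))).add_const
      (1 / (2 - m))) using 1
    rw [show (2 - m - 1) = 1 - m by ring]
    field_simp

theorem hasDerivAt_powerBregmanDeriv {m c : ℝ} (hc : 0 < c) :
    HasDerivAt (powerBregmanDeriv m) (c ^ (-m)) c := by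
  unfold powerBregmanDeriv
  split_ifs with h1
  · subst h1
    rw [Real.rpow_neg_one]
    exact Real.hasDerivAt_log hc.ne'
  · have h1' : 1 - m ≠ 0 := sub_ne_zero.2 (Ne.symm h1)
    convert! ((Real.hasDerivAt_rpow_const (x := c) (p := 1 - m) (Or.inl hc.ne')).sub_const
      1).div_const (1 - m) using 1
    rw [show (1 - m - 1) = -m by ring]
    field_simp

theorem powerBregman_one {m : ℝ} (hm : m < 2) : powerBregman m 1 = 0 := by
  unfold powerBregman
  split_ifs with h1
  · simp
  · have h1' : 1 - m ≠ 0 := sub_ne_zero.2 (Ne.symm h1)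
    have h2' : 2 - m ≠ 0 := by linarith
    rw [Real.one_rpow]; field_simp; ring

theorem powerBregmanDeriv_one (m : ℝ) : powerBregmanDeriv m 1 = 0 := by
  unfold powerBregmanDeriv
  split_ifs <;> simp

theorem powerBregman_zero {m : ℝ} (hm : m < 2) : powerBregman m 0 = 1 / (2 - m) := by
  unfold powerBregman
  split_ifs with h1
  · subst h1; norm_num
  · rw [Real.zero_rpow (by linarith)]; simp

theorem continuous_powerBregman {m : ℝ} (hm : m < 2) : Continuous (powerBregman m) := by
  unfold powerBregman
  split_ifs with h1
  · exact (Real.continuous_mul_log.sub continuous_id).add continuous_const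
  · exact (((Real.continuous_rpow_const (by linarith)).div_const _).sub
      (continuous_id.div_const _)).add continuous_const

/-- A function vanishing to first order at `1` with nonnegative second derivative is nonnegative. -/
theorem nonneg_of_second_deriv_nonneg {F F₁ F₂ : ℝ → ℝ} {c : ℝ}
    (h : ∀ x ∈ uIcc 1 c, HasDerivAt F (F₁ x) x) (h₁ : ∀ x ∈ uIcc 1 c, HasDerivAt F₁ (F₂ x) x)
    (h₂ : ∀ x ∈ uIcc 1 c, 0 ≤ F₂ x) (h0 : F 1 = 0) (h10 : F₁ 1 = 0) : 0 ≤ F c := by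
  have hconv : Convex ℝ (uIcc 1 c) := convex_uIcc 1 c
  have hmono : MonotoneOn F₁ (uIcc 1 c) := by
    refine monotoneOn_of_deriv_nonneg hconv
      (fun x hx => (h₁ x hx).continuousAt.continuousWithinAt)
      (fun x hx => (h₁ x (interior_subset hx)).differentiableAt.differentiableWithinAt)
      fun x hx => ?_
    rw [(h₁ x (interior_subset hx)).deriv]
    exact h₂ x (interior_subset hx)
  have hcont : ContinuousOn F (uIcc 1 c) := fun x hx => (h x hx).continuousAt.continuousWithinAt
  have hdiff : DifferentiableOn ℝ F (interior (uIcc 1 c)) := fun x hx =>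
    (h x (interior_subset hx)).differentiableAt.differentiableWithinAt
  rcases le_total 1 c with hc | hc
  · have : MonotoneOn F (uIcc 1 c) := by
      refine monotoneOn_of_deriv_nonneg hconv hcont hdiff fun x hx => ?_
      have hx' := interior_subset hx
      rw [(h x hx').deriv, ← h10]
      refine hmono left_mem_uIcc hx' ?_
      rw [uIcc_of_le hc] at hx'
      exact hx'.1
    rw [← h0]
    exact this left_mem_uIcc right_mem_uIcc hc
  · have : AntitoneOn F (uIcc 1 c) := by
      refine antitoneOn_of_deriv_nonpos hconv hcont hdiff fun x hx => ?_
      have hx' := interior_subset hx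
      rw [(h x hx').deriv, ← h10]
      refine hmono hx' left_mem_uIcc ?_
      rw [uIcc_of_ge hc] at hx'
      exact hx'.2
    rw [← h0]
    exact this right_mem_uIcc left_mem_uIcc hc

namespace IsTameDeformation

variable {φ : ℝ → ℝ} {δ θ : ℝ}

/-- As functions of c, both sides vanish to first order at 1. Their second derivatives are s²/φ(cs)
and s² c^(-m)/φ(s), which the growth hypothesis compares. -/
theorem bregman_le_of_growth (h : IsTameDeformation φ δ θ) {m s c : ℝ} (hm : m < 2) (hs : 0 < s)
    (hc : 0 < c) (hg : ∀ x ∈ uIcc 1 c, x ^ m * φ s ≤ φ (x * s)) :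
    phiU φ (c * s) - phiU φ s - (c * s - s) * phiLog φ s ≤ s ^ 2 / φ s * powerBregman m c := by
  have hpos : ∀ x ∈ uIcc 1 c, 0 < x := fun x hx => (lt_min one_pos hc).trans_le hx.1
  have := nonneg_of_second_deriv_nonneg (c := c)
    (F := fun x => s ^ 2 / φ s * powerBregman m x -
      (phiU φ (x * s) - phiU φ s - (x * s - s) * phiLog φ s))
    (F₁ := fun x => s ^ 2 / φ s * powerBregmanDeriv m x - (phiLog φ (x * s) * s - s * phiLog φ s))
    (F₂ := fun x => s ^ 2 / φ s * x ^ (-m) - (1 / φ (x * s) * s * s))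
    (fun x hx => by
      have hx0 := hpos x hx
      have hmul : HasDerivAt (fun x : ℝ => x * s) s x := by
        simpa using (hasDerivAt_id x).mul_const s
      exact ((hasDerivAt_powerBregman hm hx0).const_mul _).sub
        ((((h.hasDerivAt_phiU (mul_pos hx0 hs)).comp x hmul).sub_const _).sub
          ((hmul.sub_const s).mul_const _)))
    (fun x hx => by
      have hx0 := hpos x hx
      have hmul : HasDerivAt (fun x : ℝ => x * s) s x := by
        simpa using (hasDerivAt_id x).mul_const s
      exact ((hasDerivAt_powerBregmanDeriv hx0).const_mul _).sub
        ((((h.isDeformation.hasDerivAt_phiLog (mul_pos hx0 hs)).comp x hmul).mul_const s).sub_const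
          _))
    (fun x hx => by
      have hx0 := hpos x hx
      have h1 := h.isDeformation.pos s hs
      have h2 := h.isDeformation.pos (x * s) (mul_pos hx0 hs)
      have h3 := Real.rpow_pos_of_pos hx0 m
      have h4 := hg x hx
      have : 1 / φ (x * s) ≤ 1 / (x ^ m * φ s) := one_div_le_one_div_of_le (by positivity) h4
      rw [Real.rpow_neg hx0.le]
      have e : s ^ 2 / φ s * (x ^ m)⁻¹ = 1 / (x ^ m * φ s) * s * s := by
        field_simp
      rw [e, sub_nonneg]
      gcongr)
    (by simp [powerBregman_one hm]) (by simp [powerBregmanDeriv_one, mul_comm])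
  linarith

theorem bregman_mul_le (h : IsTameDeformation φ δ θ) {s c : ℝ} (hs : 0 < s)
    (hc : 1 ≤ c) :
    phiU φ (c * s) - phiU φ s - (c * s - s) * phiLog φ s ≤ s ^ 2 / φ s * powerBregman δ c := by
  have hδθ := h.growth.lower_le_upper h.isDeformation
  refine h.bregman_le_of_growth (by have := h.upper_lt; linarith) hs (by linarith) fun x hx => ?_
  rw [uIcc_of_le hc] at hx
  exact h.growth.lower s hs x hx.1

/-- The limit c → 0 of the Bregman bound with m = θ: for ratios below 1 it is the upper growth
exponent that bounds φ(cs) from below. -/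
theorem bregman_zero_le (h : IsTameDeformation φ δ θ) {s : ℝ} (hs : 0 < s) :
    s * phiLog φ s - phiU φ s ≤ s ^ 2 / φ s * (1 / (2 - θ)) := by
  have hθ : θ < 2 := by have := h.upper_lt; linarith
  have key : ∀ c ∈ Ioc (0 : ℝ) 1, phiU φ (c * s) - phiU φ s - (c * s - s) * phiLog φ s
      ≤ s ^ 2 / φ s * powerBregman θ c := fun c hc => by
    refine h.bregman_le_of_growth hθ hs hc.1 fun x hx => ?_
    rw [uIcc_of_ge hc.2] at hx
    exact h.growth.le_of_le_one hs (hc.1.trans_le hx.1) hx.2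
  have hev : ∀ᶠ c in 𝓝[>] (0 : ℝ), phiU φ (c * s) - phiU φ s - (c * s - s) * phiLog φ s
      ≤ s ^ 2 / φ s * powerBregman θ c := by
    filter_upwards [Ioc_mem_nhdsGT one_pos] with c hc using key c hc
  have hmul : Tendsto (fun c : ℝ => c * s) (𝓝[>] 0) (𝓝 0) := by
    have : Tendsto (fun c : ℝ => c * s) (𝓝 0) (𝓝 (0 * s)) :=
      (continuous_id.mul continuous_const).tendsto 0
    rw [zero_mul] at this
    exact this.mono_left nhdsWithin_le_nhds
  have hl : Tendsto (fun c : ℝ => phiU φ (c * s) - phiU φ s - (c * s - s) * phiLog φ s) (𝓝[>] 0)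
      (𝓝 (phiU φ 0 - phiU φ s - (0 - s) * phiLog φ s)) := by
    have hu : Tendsto (fun c : ℝ => phiU φ (c * s)) (𝓝[>] 0) (𝓝 (phiU φ 0)) := by
      refine (h.continuousOn_phiU 0 (mem_Ici.2 le_rfl)).tendsto.comp ?_
      refine tendsto_nhdsWithin_iff.2 ⟨hmul, eventually_nhdsWithin_of_forall fun c hc => ?_⟩
      exact (mul_pos hc hs).le
    exact (hu.sub_const _).sub ((hmul.sub_const s).mul_const _)
  have hr : Tendsto (fun c : ℝ => s ^ 2 / φ s * powerBregman θ c) (𝓝[>] 0)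
      (𝓝 (s ^ 2 / φ s * powerBregman θ 0)) :=
    (((continuous_powerBregman hθ).tendsto 0).mono_left nhdsWithin_le_nhds).const_mul _
  have := le_of_tendsto_of_tendsto hl hr hev
  rw [powerBregman_zero hθ, phiU_zero] at this
  linarith

end IsTameDeformation

/-! ### The deformed exponential and the reference density -/

theorem phiLogInf_le {φ : ℝ → ℝ} {t : ℝ} (ht : 0 < t) : phiLogInf φ ≤ (phiLog φ t : EReal) :=
  biInf_le (fun t => (phiLog φ t : EReal)) (mem_Ioi.2 ht)

theorem le_phiLogSup {φ : ℝ → ℝ} {t : ℝ} (ht : 0 < t) : (phiLog φ t : EReal) ≤ phiLogSup φ :=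
  le_biSup (fun t => (phiLog φ t : EReal)) (mem_Ioi.2 ht)

namespace IsDeformation

variable {φ : ℝ → ℝ}

theorem exists_phiLog_eq (hφ : IsDeformation φ) {τ : ℝ} (h₁ : phiLogInf φ < (τ : EReal))
    (h₂ : (τ : EReal) < phiLogSup φ) : ∃ t ∈ Ioi (0 : ℝ), phiLog φ t = τ := by
  simp only [phiLogInf, iInf_lt_iff, EReal.coe_lt_coe_iff] at h₁
  simp only [phiLogSup, lt_iSup_iff, EReal.coe_lt_coe_iff] at h₂
  obtain ⟨t₁, ht₁, h₁⟩ := h₁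
  obtain ⟨t₂, ht₂, h₂⟩ := h₂
  exact isPreconnected_Ioi.intermediate_value ht₁ ht₂ hφ.continuousOn_phiLog ⟨h₁.le, h₂.le⟩

theorem monotone_phiExp (hφ : IsDeformation φ) : Monotone (phiExp φ) := by
  intro τ₁ τ₂ h
  have hE : (τ₁ : EReal) ≤ (τ₂ : EReal) := EReal.coe_le_coe_iff.2 h
  unfold phiExp
  by_cases h1 : (τ₁ : EReal) ≤ phiLogInf φ
  · simp [h1]
  by_cases h2 : phiLogSup φ ≤ (τ₂ : EReal)
  · have : ¬ (τ₂ : EReal) ≤ phiLogInf φ := fun h' => h1 (hE.trans h')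
    simp [this, h2]
  have h1' : ¬ (τ₂ : EReal) ≤ phiLogInf φ := fun h' => h1 (hE.trans h')
  have h2' : ¬ phiLogSup φ ≤ (τ₁ : EReal) := fun h' => h2 (h'.trans hE)
  simp only [h1, h2, h1', h2', if_false]
  have e₁ := hφ.exists_phiLog_eq (not_le.1 h1) (not_le.1 h2')
  have e₂ := hφ.exists_phiLog_eq (not_le.1 h1') (not_le.1 h2)
  refine ENNReal.ofReal_le_ofReal ?_
  rw [← hφ.strictMonoOn_phiLog.le_iff_le (Function.invFunOn_mem e₁) (Function.invFunOn_mem e₂),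
    Function.invFunOn_eq e₁, Function.invFunOn_eq e₂]
  exact h

end IsDeformation

theorem phiExp_ne_top {φ : ℝ → ℝ} {τ : ℝ} (h : (τ : EReal) < phiLogSup φ) : phiExp φ τ ≠ ⊤ := by
  unfold phiExp
  rw [if_neg (not_le.2 h)]
  split_ifs <;> simp

theorem IsDeformation.le_phiLogInf_of_phiExp_eq_zero {φ : ℝ → ℝ} (hφ : IsDeformation φ) {τ : ℝ}
    (h : (τ : EReal) < phiLogSup φ) (h0 : phiExp φ τ = 0) : (τ : EReal) ≤ phiLogInf φ := by
  by_contra h1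
  have e := hφ.exists_phiLog_eq (not_le.1 h1) h
  simp only [phiExp, h1, not_le.2 h, if_false, ENNReal.ofReal_eq_zero] at h0
  exact absurd (Function.invFunOn_mem e) (not_lt.2 h0)

/-- Since φ(s) ≤ s^θ above 1 and φ(s) ≥ s^θ below 1, ln_φ dominates the logarithm of s^θ on both
sides. Admissibility bounds Ψ by the supremum of the latter, so this yields -Ψ < L_φ and a finite
density σ. -/
theorem IsTameDeformation.phiLogSup_powerDeformation_le {φ : ℝ → ℝ} {δ θ : ℝ}
    (h : IsTameDeformation φ δ θ) : phiLogSup (powerDeformation (2 - θ)) ≤ phiLogSup φ := by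
  refine iSup₂_mono fun t ht => EReal.coe_le_coe_iff.2 ?_
  have ht : (0 : ℝ) < t := ht
  have hφ := h.isDeformation
  have hp : ∀ s, powerDeformation (2 - θ) s = s ^ θ := fun s => by
    simp [powerDeformation]
  have hc : ContinuousOn (fun s => 1 / powerDeformation (2 - θ) s) (Ioi 0) := by
    simp only [hp]
    exact continuousOn_const.div
      (fun x hx => (Real.continuousAt_rpow_const x θ (Or.inl (ne_of_gt hx))).continuousWithinAt)
      fun x hx => (Real.rpow_pos_of_pos hx θ).ne'
  have hi : ∀ a b : ℝ, 0 < a → 0 < b →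
      IntervalIntegrable (fun s => 1 / powerDeformation (2 - θ) s) volume a b := fun a b ha hb =>
    (hc.mono fun _ hx => (lt_min ha hb).trans_le hx.1).intervalIntegrable
  unfold phiLog
  rcases le_total 1 t with h1 | h1
  · refine intervalIntegral.integral_mono_on h1 (hi _ _ one_pos ht)
      (hφ.intervalIntegrable_one_div one_pos ht) fun x hx => ?_
    have hx0 : 0 < x := one_pos.trans_le hx.1
    rw [hp]
    exact one_div_le_one_div_of_le (hφ.pos x hx0) (h.le_rpow hx.1)
  · rw [intervalIntegral.integral_symm, intervalIntegral.integral_symm t 1, neg_le_neg_iff]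
    refine intervalIntegral.integral_mono_on h1 (hφ.intervalIntegrable_one_div ht one_pos)
      (hi _ _ ht one_pos) fun x hx => ?_
    have hx0 : 0 < x := ht.trans_le hx.1
    rw [hp]
    exact one_div_le_one_div_of_le (Real.rpow_pos_of_pos hx0 θ) (h.rpow_le hx0 hx.2)

theorem refDensity_nonneg {M : Type*} (φ : ℝ → ℝ) (Ψ : M → ℝ) (x : M) : 0 ≤ refDensity φ Ψ x :=
  ENNReal.toReal_nonneg

theorem IsDeformation.measurable_phiExp_neg {M : Type*} [MeasurableSpace M] {φ : ℝ → ℝ}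
    (hφ : IsDeformation φ) {Ψ : M → ℝ} (hΨ : Measurable Ψ) :
    Measurable fun x => phiExp φ (-Ψ x) :=
  hφ.monotone_phiExp.measurable.comp hΨ.neg

theorem IsDeformation.measurable_refDensity {M : Type*} [MeasurableSpace M] {φ : ℝ → ℝ}
    (hφ : IsDeformation φ) {Ψ : M → ℝ} (hΨ : Measurable Ψ) : Measurable (refDensity φ Ψ) :=
  (hφ.measurable_phiExp_neg hΨ).ennreal_toReal

/-- Off the support -Ψ ≤ l_φ, because the other alternative is excluded by -Ψ < L_φ; hence σ = 0
there. Conditionings of ν are therefore allowed as endpoints in the convexity hypothesis. -/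
theorem refMeasure_compl_refSupport {M : Type*} [MeasurableSpace M] {ω : Measure M} {φ : ℝ → ℝ}
    {Ψ : M → ℝ} (hΨ : Measurable Ψ) (hlt : ∀ x, ((-Ψ x : ℝ) : EReal) < phiLogSup φ) :
    refMeasure ω φ Ψ (refSupport φ Ψ)ᶜ = 0 := by
  have hm : MeasurableSet (refSupport φ Ψ) :=
    (measurableSet_lt measurable_const hΨ.coe_real_ereal).inter
      (measurableSet_lt hΨ.coe_real_ereal measurable_const)
  rw [refMeasure, withDensity_apply _ hm.compl]
  refine (setLIntegral_congr_fun hm.compl fun x hx => ?_).trans lintegral_zero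
  have h1 : -phiLogSup φ < (Ψ x : EReal) := by
    have := EReal.neg_lt_neg_iff.2 (hlt x)
    simpa using this
  have h2 : ¬ (Ψ x : EReal) < -phiLogInf φ := fun h2 => hx ⟨h1, h2⟩
  have h3 : ((-Ψ x : ℝ) : EReal) ≤ phiLogInf φ := by
    have := EReal.neg_le_neg_iff.2 (not_lt.1 h2)
    simpa using this
  simp only [phiExp, h3, if_true]

/-! ### Pointwise estimates for the entropy density -/

theorem phiHDeriv_of_pos {φ : ℝ → ℝ} {s : ℝ} (hs : 0 < s) :
    phiHDeriv φ s = phiLog φ s - phiShift φ := by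
  rw [phiHDeriv, if_neg hs.ne']

namespace IsTameDeformation

variable {φ : ℝ → ℝ} {δ θ : ℝ}

/-- The tangent inequality for `h_φ`, including the tangent at `0` when it exists. -/
theorem phiH_sub_le (h : IsTameDeformation φ δ θ) {s r : ℝ} (hs : 0 ≤ s) (hr : 0 ≤ r)
    (h0 : s = 0 → phiLogInf φ ≠ ⊥) :
    phiH φ s - s * phiHDeriv φ s ≤ phiH φ r - r * phiHDeriv φ s := by
  rcases hs.eq_or_lt with rfl | hs
  · have hbot := h0 rfl
    have htop : phiLogInf φ ≠ ⊤ := fun ht => by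
      have := phiLogInf_le (φ := φ) one_pos
      rw [ht] at this
      exact absurd this (by simp)
    have hle : ∀ t, 0 < t → (phiLogInf φ).toReal ≤ phiLog φ t := fun t ht => by
      have := phiLogInf_le (φ := φ) ht
      rw [← EReal.coe_toReal htop hbot] at this
      exact EReal.coe_le_coe_iff.1 this
    have : r * (phiLogInf φ).toReal ≤ phiU φ r := by
      have h1 : ∫ _ in (0 : ℝ)..r, (phiLogInf φ).toReal ≤ ∫ t in (0 : ℝ)..r, phiLog φ t := by
        refine intervalIntegral.integral_mono_on_of_le_Ioo hr (by simp)
          (h.intervalIntegrable_phiLog hr) fun x hx => hle x hx.1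
      simpa [phiU] using h1
    simp only [phiHDeriv, if_true, phiH, phiU_zero]
    linarith
  · have := h.tangent_le_phiU hs hr
    rw [phiHDeriv_of_pos hs, phiH, phiH]
    linarith

/-- The shift by L_φ in h_φ is chosen so that h_φ' = ln_φ - L_φ ≤ 0. Singular mass then cannot lower
the entropy. -/
theorem _root_.phiHDeriv_nonpos (hL : phiLogSup φ ≠ ⊤) {s : ℝ}
    (hs : 0 ≤ s) (h0 : s = 0 → phiLogInf φ ≠ ⊥) : phiHDeriv φ s ≤ 0 := by
  have hLbot : phiLogSup φ ≠ ⊥ := fun hb => by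
    have := le_phiLogSup (φ := φ) one_pos
    rw [hb] at this
    exact absurd this (by simp)
  have hle : ∀ t, 0 < t → phiLog φ t ≤ (phiLogSup φ).toReal := fun t ht => by
    have := le_phiLogSup (φ := φ) ht
    rw [← EReal.coe_toReal hL hLbot] at this
    exact EReal.coe_le_coe_iff.1 this
  rw [phiHDeriv, phiShift, if_neg hL]
  split_ifs with hs0
  · have := EReal.toReal_le_toReal (phiLogInf_le (φ := φ) one_pos) (h0 hs0) (by simp)
    have h2 := hle 1 one_pos
    simp only [EReal.toReal_coe] at this
    linarith
  · have := hle s (lt_of_le_of_ne hs (Ne.symm hs0))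
    linarith

/-- The linear term r L_φ drops out of a Bregman divergence, so this is the bound for u_φ; at s = 0
both sides vanish. -/
theorem phiH_mul_sub_le (h : IsTameDeformation φ δ θ) {s c : ℝ} (hs : 0 ≤ s) (hc : 1 ≤ c) :
    phiH φ (c * s) - c * s * phiHDeriv φ s - (phiH φ s - s * phiHDeriv φ s)
      ≤ s ^ 2 / φ s * powerBregman δ c := by
  rcases hs.eq_or_lt with rfl | hs
  · simp [phiH_zero]
  · have := h.bregman_mul_le hs hc
    rw [phiHDeriv_of_pos hs, phiH, phiH]
    linarith

theorem neg_phiH_sub_le (h : IsTameDeformation φ δ θ) {s : ℝ} (hs : 0 ≤ s) :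
    -(phiH φ s - s * phiHDeriv φ s) ≤ s ^ 2 / φ s * (1 / (2 - θ)) := by
  rcases hs.eq_or_lt with rfl | hs
  · simp [phiH_zero]
  · have := h.bregman_zero_le hs
    rw [phiHDeriv_of_pos hs, phiH]
    linarith

/-- Continuity of h_φ is available only on [0,∞); the truncation extends it to the whole line
without changing its values on densities. -/
theorem measurable_phiH_max (h : IsTameDeformation φ δ θ) :
    Measurable fun r => phiH φ (max r 0) := by
  have : Continuous fun r => phiU φ (max r 0) :=
    h.continuousOn_phiU.comp_continuous (continuous_id.max continuous_const) fun r =>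
      le_max_right r 0
  have h2 : Continuous fun r => phiH φ (max r 0) :=
    this.sub ((continuous_id.max continuous_const).mul continuous_const)
  exact h2.measurable

end IsTameDeformation

theorem mul_phiHDeriv (φ : ℝ → ℝ) {s : ℝ} (hs : 0 ≤ s) :
    s * phiHDeriv φ s = s * phiLog φ s - s * phiShift φ := by
  rcases hs.eq_or_lt with rfl | hs
  · simp
  · rw [phiHDeriv_of_pos hs]; ring

theorem powerBregman_nonneg {m c : ℝ} (hm : m < 2) (hc : 0 < c) : 0 ≤ powerBregman m c := by
  have hpos : ∀ x ∈ uIcc 1 c, 0 < x := fun x hx => (lt_min one_pos hc).trans_le hx.1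
  exact nonneg_of_second_deriv_nonneg (fun x hx => hasDerivAt_powerBregman hm (hpos x hx))
    (fun x hx => hasDerivAt_powerBregmanDeriv (hpos x hx))
    (fun x hx => (Real.rpow_pos_of_pos (hpos x hx) _).le) (powerBregman_one hm)
    (powerBregmanDeriv_one m)

/-! ### The relative entropy of the reference measure and of its conditionings -/

/-- The entropy density `h_φ(σ) - σ h_φ'(σ)` of the reference measure. -/
def refEntropyDensity {M : Type*} (φ : ℝ → ℝ) (Ψ : M → ℝ) (x : M) : ℝ :=
  phiH φ (refDensity φ Ψ x) - refDensity φ Ψ x * phiHDeriv φ (refDensity φ Ψ x)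

/-- The analytic content of admissibility. -/
structure IsTameReference {M : Type*} [MeasurableSpace M] (ω : Measure M) (φ : ℝ → ℝ) (δ θ : ℝ)
    (Ψ : M → ℝ) : Prop where
  tame : IsTameDeformation φ δ θ
  measurable : Measurable Ψ
  lt_sup : ∀ x, ((-Ψ x : ℝ) : EReal) < phiLogSup φ
  isProbabilityMeasure : IsProbabilityMeasure (refMeasure ω φ Ψ)
  integrable_h : Integrable (fun x => phiH φ (refDensity φ Ψ x)) ω
  integrable_log : Integrable (fun x => refDensity φ Ψ x * phiLog φ (refDensity φ Ψ x)) ω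

namespace IsTameReference

variable {M : Type*} [MeasurableSpace M] {ω : Measure M} {φ : ℝ → ℝ} {δ θ : ℝ} {Ψ : M → ℝ}

theorem measurable_refDensity (h : IsTameReference ω φ δ θ Ψ) : Measurable (refDensity φ Ψ) :=
  h.tame.isDeformation.measurable_refDensity h.measurable

theorem ofReal_refDensity (h : IsTameReference ω φ δ θ Ψ) (x : M) :
    ENNReal.ofReal (refDensity φ Ψ x) = phiExp φ (-Ψ x) :=
  ENNReal.ofReal_toReal (phiExp_ne_top (h.lt_sup x))

theorem refMeasure_eq (h : IsTameReference ω φ δ θ Ψ) :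
    refMeasure ω φ Ψ = ω.withDensity fun x => ENNReal.ofReal (refDensity φ Ψ x) := by
  simp only [refMeasure, h.ofReal_refDensity]

/-- A zero of σ forces -Ψ(x) ≤ l_φ, so l_φ > -∞. Thus the real number standing for h_φ'(0) is the
true limit whenever it is used. -/
theorem phiLogInf_ne_bot (h : IsTameReference ω φ δ θ Ψ) {x : M} (hx : refDensity φ Ψ x = 0) :
    phiLogInf φ ≠ ⊥ := by
  have h0 : phiExp φ (-Ψ x) = 0 := by rw [← h.ofReal_refDensity, hx, ENNReal.ofReal_zero]
  have := h.tame.isDeformation.le_phiLogInf_of_phiExp_eq_zero (h.lt_sup x) h0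
  intro hb
  rw [hb] at this
  exact absurd this (by simp)

theorem setIntegral_refDensity (h : IsTameReference ω φ δ θ Ψ) {E : Set M}
    (hE : MeasurableSet E) : ∫ x in E, refDensity φ Ψ x ∂ω = (refMeasure ω φ Ψ).real E := by
  rw [integral_eq_lintegral_of_nonneg_ae (ae_of_all _ fun x => refDensity_nonneg φ Ψ x)
    h.measurable_refDensity.aestronglyMeasurable, Measure.real, h.refMeasure_eq,
    withDensity_apply _ hE]

theorem integrable_refDensity (h : IsTameReference ω φ δ θ Ψ) :
    Integrable (refDensity φ Ψ) ω := by
  refine ⟨h.measurable_refDensity.aestronglyMeasurable, ?_⟩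
  rw [hasFiniteIntegral_iff_ofReal (ae_of_all _ fun x => refDensity_nonneg φ Ψ x)]
  have := h.isProbabilityMeasure.measure_univ
  rw [h.refMeasure_eq, withDensity_apply _ MeasurableSet.univ, setLIntegral_univ] at this
  rw [this]
  exact ENNReal.one_lt_top

theorem integrable_mul_phiHDeriv (h : IsTameReference ω φ δ θ Ψ) :
    Integrable (fun x => refDensity φ Ψ x * phiHDeriv φ (refDensity φ Ψ x)) ω := by
  simp only [mul_phiHDeriv φ (refDensity_nonneg φ Ψ _)]
  exact h.integrable_log.sub (h.integrable_refDensity.mul_const _)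

theorem integrable_refEntropyDensity (h : IsTameReference ω φ δ θ Ψ) :
    Integrable (refEntropyDensity φ Ψ) ω :=
  h.integrable_h.sub h.integrable_mul_phiHDeriv

theorem refEntropyDensity_le (h : IsTameReference ω φ δ θ Ψ) (x : M) {r : ℝ} (hr : 0 ≤ r) :
    refEntropyDensity φ Ψ x ≤ phiH φ r - r * phiHDeriv φ (refDensity φ Ψ x) :=
  h.tame.phiH_sub_le (refDensity_nonneg φ Ψ x) hr fun h0 => h.phiLogInf_ne_bot h0

/-- The reference measure minimizes the relative entropy. -/
theorem integral_le_relEntropy [SigmaFinite ω] (h : IsTameReference ω φ δ θ Ψ) (μ : Measure M)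
    [IsProbabilityMeasure μ] :
    ((∫ x, refEntropyDensity φ Ψ x ∂ω : ℝ) : EReal) ≤ relEntropy ω φ Ψ μ := by
  unfold relEntropy
  split_ifs with hint
  swap
  · exact le_top
  obtain ⟨hi₁, hi₂⟩ := hint
  set k : M → ℝ := fun x => phiHDeriv φ (refDensity φ Ψ x)
  set ρ : M → ℝ := fun x => (μ.rnDeriv ω x).toReal with hρ
  have hle₁ : μ.singularPart ω ≤ μ := μ.singularPart_le ω
  have hle₂ : ω.withDensity (μ.rnDeriv ω) ≤ μ := μ.withDensity_rnDeriv_le ω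
  have hks : Integrable k (μ.singularPart ω) := hi₂.mono_measure hle₁
  have hka : Integrable k (ω.withDensity (μ.rnDeriv ω)) := hi₂.mono_measure hle₂
  have hkρ : Integrable (fun x => ρ x * k x) ω := by
    have := (integrable_withDensity_iff_integrable_smul' (μ.measurable_rnDeriv ω)
      (μ.rnDeriv_lt_top ω)).1 hka
    simpa only [smul_eq_mul] using this
  have hsplit : ∫ x, k x ∂μ = ∫ x, k x ∂(μ.singularPart ω) + ∫ x, ρ x * k x ∂ω := by
    conv_lhs => rw [μ.haveLebesgueDecomposition_add ω]
    rw [integral_add_measure hks hka, integral_withDensity_eq_integral_toReal_smul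
      (μ.measurable_rnDeriv ω) (μ.rnDeriv_lt_top ω)]
    simp only [smul_eq_mul, hρ]
  -- Integrated tangent inequality for h_φ at σ, applied to the absolutely continuous part.
  have hmain : ∫ x, refEntropyDensity φ Ψ x ∂ω ≤ ∫ x, phiH φ (ρ x) ∂ω - ∫ x, ρ x * k x ∂ω := by
    rw [← integral_sub hi₁ hkρ]
    exact integral_mono h.integrable_refEntropyDensity (hi₁.sub hkρ) fun x =>
      h.refEntropyDensity_le x ENNReal.toReal_nonneg
  -- If L_φ = ∞, any singular mass makes the entropy infinite. If L_φ < ∞, its explicit cost is 0,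
  -- but -∫ h_φ'(σ) dμ^s is nonnegative.
  unfold phiHDerivTop
  split_ifs with hL
  · rcases eq_or_ne (μ.singularPart ω) 0 with hs | hs
    · rw [hs]
      simp only [Measure.coe_zero, Pi.zero_apply, EReal.coe_ennreal_zero, mul_zero, add_zero]
      rw [EReal.coe_le_coe_iff, hsplit, hs, integral_zero_measure]
      linarith
    · have : (0 : EReal) < (μ.singularPart ω univ : EReal) := by
        rw [EReal.coe_ennreal_pos]
        exact pos_iff_ne_zero.2 (Measure.measure_univ_ne_zero.2 hs)
      rw [EReal.top_mul_of_pos this, EReal.coe_add_top]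
      exact le_top
  · rw [zero_mul, add_zero, EReal.coe_le_coe_iff, hsplit]
    have : ∫ x, k x ∂(μ.singularPart ω) ≤ 0 := integral_nonpos fun x =>
      phiHDeriv_nonpos hL (refDensity_nonneg φ Ψ x) fun h0 => h.phiLogInf_ne_bot h0
    linarith

theorem cond_refMeasure_eq (h : IsTameReference ω φ δ θ Ψ) {A : Set M} (hA : MeasurableSet A)
    (hA0 : refMeasure ω φ Ψ A ≠ 0) :
    ProbabilityTheory.cond (refMeasure ω φ Ψ) A = ω.withDensity fun x =>
      ENNReal.ofReal (A.indicator (fun x => ((refMeasure ω φ Ψ).real A)⁻¹ * refDensity φ Ψ x) x) := by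
  have := h.isProbabilityMeasure
  have hpos : 0 < (refMeasure ω φ Ψ).real A :=
    ENNReal.toReal_pos hA0 (measure_ne_top _ _)
  rw [ProbabilityTheory.cond]
  conv_lhs => rw [h.refMeasure_eq, restrict_withDensity hA, ← withDensity_indicator hA,
    ← h.refMeasure_eq]
  rw [← withDensity_smul _ (h.measurable_refDensity.ennreal_ofReal.indicator hA)]
  congr 1
  ext x
  by_cases hx : x ∈ A
  · simp only [Pi.smul_apply, hx, indicator_of_mem, smul_eq_mul]
    rw [ENNReal.ofReal_mul (by positivity), ENNReal.ofReal_inv_of_pos hpos, Measure.real,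
      ENNReal.ofReal_toReal (measure_ne_top _ _)]
  · simp [hx]

/-- The relative entropy of the conditioning of the reference measure to a set, measured relative
to the minimal value of the entropy. -/
theorem exists_relEntropy_cond_eq [SigmaFinite ω] (h : IsTameReference ω φ δ θ Ψ) {q : M → ℝ}
    (hq : Integrable q ω)
    (hle : ∀ᵐ x ∂ω, refDensity φ Ψ x ^ 2 / φ (refDensity φ Ψ x) ≤ q x)
    {A : Set M} (hA : MeasurableSet A) (hA0 : refMeasure ω φ Ψ A ≠ 0) :
    ∃ H : ℝ, relEntropy ω φ Ψ (ProbabilityTheory.cond (refMeasure ω φ Ψ) A) = (H : EReal) ∧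
      H - ∫ x, refEntropyDensity φ Ψ x ∂ω ≤
        (∫ x in A, q x ∂ω) * powerBregman δ ((refMeasure ω φ Ψ).real A)⁻¹
          + (∫ x in Aᶜ, q x ∂ω) * (1 / (2 - θ)) := by
  have := h.isProbabilityMeasure
  have hδθ := h.tame.growth.lower_le_upper h.tame.isDeformation
  have hθ := h.tame.upper_lt
  set a := (refMeasure ω φ Ψ).real A
  have hpos : 0 < a := ENNReal.toReal_pos hA0 (measure_ne_top _ _)
  have hc1 : 1 ≤ a⁻¹ := (one_le_inv₀ hpos).2 measureReal_le_one
  set c := a⁻¹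
  have hg : 0 ≤ powerBregman δ c := powerBregman_nonneg (by linarith) (by linarith)
  set σ := refDensity φ Ψ
  set e := refEntropyDensity φ Ψ
  set k : M → ℝ := fun x => phiHDeriv φ (σ x)
  set ρ : M → ℝ := A.indicator fun x => c * σ x with hρdef
  have hσ0 : ∀ x, 0 ≤ σ x := refDensity_nonneg φ Ψ
  have hρ0 : ∀ x, 0 ≤ ρ x := fun x =>
    indicator_nonneg (fun x _ => mul_nonneg (by linarith) (hσ0 x)) x
  have hρm : Measurable ρ := (h.measurable_refDensity.const_mul c).indicator hA
  have hσk : Integrable (fun x => σ x * k x) ω := h.integrable_mul_phiHDeriv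
  have hcσk : Integrable (fun x => c * σ x * k x) ω := by
    simpa only [mul_assoc] using hσk.const_mul c
  -- Integrability of h_φ(cσ) is not assumed. It follows by squeezing between the tangent line and
  -- the tangent line plus the Bregman bound.
  have hupper : ∀ᵐ x ∂ω, phiH φ (c * σ x) ≤ c * σ x * k x + e x + q x * powerBregman δ c := by
    filter_upwards [hle] with x hx
    have h1 := h.tame.phiH_mul_sub_le (hσ0 x) hc1
    have h2 := mul_le_mul_of_nonneg_right hx hg
    change phiH φ (c * σ x) - c * σ x * k x - e x ≤ _ at h1
    linarith
  have hlower : ∀ x, c * σ x * k x + e x ≤ phiH φ (c * σ x) := fun x => by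
    have h1 := h.refEntropyDensity_le x (r := c * σ x) (mul_nonneg (by linarith) (hσ0 x))
    change e x ≤ phiH φ (c * σ x) - c * σ x * k x at h1
    linarith
  have hphi : Integrable (fun x => phiH φ (c * σ x)) ω := by
    refine integrable_of_le_of_le ?_ (ae_of_all _ hlower) hupper
      (hcσk.add h.integrable_refEntropyDensity)
      ((hcσk.add h.integrable_refEntropyDensity).add (hq.mul_const _))
    have hm : Measurable fun x => phiH φ (max (c * σ x) 0) :=
      h.tame.measurable_phiH_max.comp (h.measurable_refDensity.const_mul c)
    refine hm.aestronglyMeasurable.congr (ae_of_all _ fun x => ?_)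
    simp only
    rw [max_eq_left (mul_nonneg (by linarith) (hσ0 x))]
  have hphiρ : (fun x => phiH φ (ρ x)) = A.indicator fun x => phiH φ (c * σ x) := by
    ext x
    by_cases hx : x ∈ A <;> simp [hρdef, hx, phiH_zero]
  have hkρ : (fun x => ρ x * k x) = A.indicator fun x => c * σ x * k x := by
    ext x
    by_cases hx : x ∈ A <;> simp [hρdef, hx]
  have hphiρi : Integrable (fun x => phiH φ (ρ x)) ω := by
    rw [hphiρ]; exact hphi.indicator hA
  have hkρi : Integrable (fun x => ρ x * k x) ω := by
    rw [hkρ]; exact hcσk.indicator hA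
  have hcond := h.cond_refMeasure_eq hA hA0
  have hrn : (fun x => (((ProbabilityTheory.cond (refMeasure ω φ Ψ) A).rnDeriv ω x).toReal))
      =ᵐ[ω] ρ := by
    rw [hcond]
    filter_upwards [Measure.rnDeriv_withDensity ω hρm.ennreal_ofReal] with x hx
    rw [hx, ENNReal.toReal_ofReal (hρ0 x)]
  have hrnH : (fun x => phiH φ (((ProbabilityTheory.cond (refMeasure ω φ Ψ) A).rnDeriv ω x).toReal))
      =ᵐ[ω] fun x => phiH φ (ρ x) := hrn.fun_comp (phiH φ)
  have hki : Integrable k (ProbabilityTheory.cond (refMeasure ω φ Ψ) A) := by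
    rw [hcond, integrable_withDensity_iff_integrable_smul' hρm.ennreal_ofReal
      (ae_of_all _ fun x => ENNReal.ofReal_lt_top)]
    refine hkρi.congr (ae_of_all _ fun x => ?_)
    simp only [smul_eq_mul]
    rw [ENNReal.toReal_ofReal (hρ0 x)]
  have hkint : ∫ x, k x ∂(ProbabilityTheory.cond (refMeasure ω φ Ψ) A) = ∫ x, ρ x * k x ∂ω := by
    rw [hcond, integral_withDensity_eq_integral_toReal_smul hρm.ennreal_ofReal
      (ae_of_all _ fun x => ENNReal.ofReal_lt_top)]
    refine integral_congr_ae (ae_of_all _ fun x => ?_)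
    simp only [smul_eq_mul]
    rw [ENNReal.toReal_ofReal (hρ0 x)]
  have hsing : (ProbabilityTheory.cond (refMeasure ω φ Ψ) A).singularPart ω = 0 := by
    rw [hcond]; exact Measure.singularPart_withDensity ω _
  refine ⟨∫ x, phiH φ (ρ x) ∂ω - ∫ x, ρ x * k x ∂ω, ?_, ?_⟩
  · rw [relEntropy, if_pos ⟨hphiρi.congr hrnH.symm, hki⟩, hsing, integral_congr_ae hrnH, hkint]
    simp
  -- The excess is split over `A`, where the density ratio is c, and over its complement, where the
  -- ratio is 0.
  · have hd : Integrable (fun x => phiH φ (ρ x) - ρ x * k x) ω := hphiρi.sub hkρi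
    have hde : Integrable (fun x => phiH φ (ρ x) - ρ x * k x - e x) ω :=
      hd.sub h.integrable_refEntropyDensity
    rw [← integral_sub hphiρi hkρi, ← integral_sub hd h.integrable_refEntropyDensity,
      ← integral_add_compl hA hde, ← integral_mul_const, ← integral_mul_const]
    refine add_le_add (setIntegral_mono_on_ae hde.integrableOn
      (hq.mul_const _).integrableOn hA ?_) (setIntegral_mono_on_ae hde.integrableOn
      (hq.mul_const _).integrableOn hA.compl ?_)
    · filter_upwards [hupper] with x hx hxA
      simp only [hρdef, indicator_of_mem hxA]
      linarith
    · filter_upwards [hle] with x hx hxA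
      simp only [hρdef, indicator_of_notMem (show x ∉ A from hxA), phiH_zero]
      have h1 := h.tame.neg_phiH_sub_le (hσ0 x)
      change -(e x) ≤ _ at h1
      have h2 : 0 ≤ 1 / (2 - θ) := by apply one_div_nonneg.2; linarith
      have h3 := mul_le_mul_of_nonneg_right hx h2
      change σ x ^ 2 / φ (σ x) * _ ≤ _ at h3
      linarith

end IsTameReference

/-! ### Wasserstein distances of measures with bounded support -/

section Wasserstein

variable {M : Type*} [MetricSpace M] [MeasurableSpace M]

/-- Every coupling is concentrated on A × B, where the cost is at least r². -/
theorem le_wassersteinTwo {μ ν : Measure M} [IsProbabilityMeasure μ] {A B : Set M}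
    (hA : MeasurableSet A) (hB : MeasurableSet B) (hμ : μ Aᶜ = 0) (hν : ν Bᶜ = 0) {r : ℝ≥0∞}
    (hr : ∀ x ∈ A, ∀ y ∈ B, r ≤ edist x y) : r ≤ wassersteinTwo μ ν := by
  refine le_iInf₂ fun q hq => ?_
  have hq1 : q univ = 1 := by
    have : (q.map Prod.fst) univ = 1 := by rw [hq.1, measure_univ]
    rwa [Measure.map_apply measurable_fst MeasurableSet.univ, preimage_univ] at this
  have hqA : ∀ᵐ z ∂q, z.1 ∈ A := by
    rw [ae_iff]
    change q (Prod.fst ⁻¹' Aᶜ) = 0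
    rw [← Measure.map_apply measurable_fst hA.compl, hq.1, hμ]
  have hqB : ∀ᵐ z ∂q, z.2 ∈ B := by
    rw [ae_iff]
    change q (Prod.snd ⁻¹' Bᶜ) = 0
    rw [← Measure.map_apply measurable_snd hB.compl, hq.2, hν]
  have h1 : r ^ 2 ≤ ∫⁻ z, edist z.1 z.2 ^ 2 ∂q := by
    calc r ^ 2 = ∫⁻ _, r ^ 2 ∂q := by rw [lintegral_const, hq1, mul_one]
      _ ≤ _ := lintegral_mono_ae (by
        filter_upwards [hqA, hqB] with z hz1 hz2
        exact pow_le_pow_left₀ zero_le (hr _ hz1 _ hz2) 2)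
  calc r = (r ^ 2) ^ (1 / 2 : ℝ) := by
        rw [← ENNReal.rpow_natCast, ← ENNReal.rpow_mul]; norm_num
    _ ≤ _ := ENNReal.rpow_le_rpow h1 (by norm_num)

/-- The product coupling has bounded cost. Finiteness matters because the convexity inequality uses
`toReal` of the distance, which would turn ∞ into 0. -/
theorem wassersteinTwo_lt_top {μ ν : Measure M} [IsProbabilityMeasure μ] [IsProbabilityMeasure ν]
    {A B : Set M} (hμ : μ Aᶜ = 0) (hν : ν Bᶜ = 0) {D : ℝ≥0∞} (hD : D ≠ ⊤)
    (hr : ∀ x ∈ A, ∀ y ∈ B, edist x y ≤ D) : wassersteinTwo μ ν < ⊤ := by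
  have hc : IsCouplingOf (μ.prod ν) μ ν := by
    constructor
    · rw [Measure.map_fst_prod, measure_univ, one_smul]
    · rw [Measure.map_snd_prod, measure_univ, one_smul]
  refine lt_of_le_of_lt (iInf₂_le (μ.prod ν) hc) (ENNReal.rpow_lt_top_of_nonneg (by norm_num) ?_)
  refine ne_top_of_le_ne_top (ENNReal.pow_ne_top hD (n := 2)) ?_
  calc ∫⁻ z, edist z.1 z.2 ^ 2 ∂(μ.prod ν) ≤ ∫⁻ _, D ^ 2 ∂(μ.prod ν) := lintegral_mono_ae (by
        have h1 : ∀ᵐ z ∂(μ.prod ν), z.1 ∈ A :=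
          Measure.quasiMeasurePreserving_fst.ae (μb := μ) (show ∀ᵐ x ∂μ, x ∈ A from hμ)
        have h2 : ∀ᵐ z ∂(μ.prod ν), z.2 ∈ B :=
          Measure.quasiMeasurePreserving_snd.ae (μb := ν) (show ∀ᵐ x ∂ν, x ∈ B from hν)
        filter_upwards [h1, h2] with z hz1 hz2
        exact pow_le_pow_left₀ zero_le (hr _ hz1 _ hz2) 2)
    _ = D ^ 2 := by rw [lintegral_const, measure_univ, mul_one]

theorem memP2_of_bounded {μ : Measure M} [IsProbabilityMeasure μ] {x₀ : M} {R : ℝ} {A : Set M}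
    (hA : A ⊆ Metric.closedBall x₀ R) (hμ : μ Aᶜ = 0) : MemP2 μ := by
  refine ⟨inferInstance, x₀, ?_⟩
  calc ∫⁻ x, edist x₀ x ^ 2 ∂μ ≤ ∫⁻ _, ENNReal.ofReal R ^ 2 ∂μ := lintegral_mono_ae (by
        filter_upwards [show ∀ᵐ x ∂μ, x ∈ A from hμ] with x hx
        refine pow_le_pow_left₀ zero_le ?_ 2
        rw [edist_comm, edist_dist]
        exact ENNReal.ofReal_le_ofReal (hA hx))
    _ < ⊤ := by
        rw [lintegral_const, measure_univ, mul_one]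
        exact ENNReal.pow_lt_top ENNReal.ofReal_lt_top

end Wasserstein

theorem cond_apply_compl {M : Type*} [MeasurableSpace M] (ν : Measure M) {A : Set M}
    (hA : MeasurableSet A) : ProbabilityTheory.cond ν A Aᶜ = 0 := by
  rw [ProbabilityTheory.cond_apply hA]; simp

/-- The convexity of the entropy at the midpoint between two separated bounded sets. -/
theorem IsTameReference.mul_sq_le_of_bounded {M : Type*} [MetricSpace M] [MeasurableSpace M]
    {ω : Measure M} [SigmaFinite ω] {φ : ℝ → ℝ} {δ θ : ℝ} {Ψ : M → ℝ}
    (h : IsTameReference ω φ δ θ Ψ) {K : ℝ} (hK : 0 < K)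
    (hHess : HessEntropyGE ω φ Ψ K) {q : M → ℝ} (hq : Integrable q ω)
    (hle : ∀ᵐ x ∂ω, refDensity φ Ψ x ^ 2 / φ (refDensity φ Ψ x) ≤ q x)
    {A B : Set M} (hA : MeasurableSet A) (hB : MeasurableSet B)
    (hA0 : refMeasure ω φ Ψ A ≠ 0) (hB0 : refMeasure ω φ Ψ B ≠ 0)
    {x₀ : M} {R : ℝ} (hAR : A ⊆ Metric.closedBall x₀ R) (hBR : B ⊆ Metric.closedBall x₀ R)
    {r : ℝ} (hr0 : 0 < r) (hr : ∀ x ∈ A, ∀ y ∈ B, r ≤ dist x y) :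
    K / 4 * r ^ 2 ≤
      ((∫ x in A, q x ∂ω) * powerBregman δ ((refMeasure ω φ Ψ).real A)⁻¹
          + (∫ x in Aᶜ, q x ∂ω) * (1 / (2 - θ)))
        + ((∫ x in B, q x ∂ω) * powerBregman δ ((refMeasure ω φ Ψ).real B)⁻¹
          + (∫ x in Bᶜ, q x ∂ω) * (1 / (2 - θ))) := by
  have := h.isProbabilityMeasure
  set ν := refMeasure ω φ Ψ
  have hpA : IsProbabilityMeasure (ProbabilityTheory.cond ν A) :=
    ProbabilityTheory.cond_isProbabilityMeasure hA0
  have hpB : IsProbabilityMeasure (ProbabilityTheory.cond ν B) :=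
    ProbabilityTheory.cond_isProbabilityMeasure hB0
  have hcA := cond_apply_compl ν hA
  have hcB := cond_apply_compl ν hB
  have hsupp : ∀ E : Set M, ProbabilityTheory.cond ν E (refSupport φ Ψ)ᶜ = 0 := fun E =>
    ProbabilityTheory.cond_absolutelyContinuous
      (refMeasure_compl_refSupport h.measurable h.lt_sup)
  obtain ⟨HA, hHA, hHA'⟩ := h.exists_relEntropy_cond_eq hq hle hA hA0
  obtain ⟨HB, hHB, hHB'⟩ := h.exists_relEntropy_cond_eq hq hle hB hB0
  obtain ⟨γ, -, -, hγ, hconv⟩ := hHess _ _ (memP2_of_bounded hAR hcA) (memP2_of_bounded hBR hcB)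
    (hsupp A) (hsupp B)
  have hhalf : (1 / 2 : ℝ) ∈ Icc (0 : ℝ) 1 := by constructor <;> norm_num
  have hpγ : IsProbabilityMeasure (γ (1 / 2)) := (hγ.1 _ hhalf).1
  -- At t = 1/2 the convexity term is K/8 times the squared distance. Doubling the inequality
  -- produces the constant K/4.
  have h1 := (h.integral_le_relEntropy (γ (1 / 2))).trans (hconv _ hhalf)
  rw [hHA, hHB] at h1
  norm_cast at h1
  have hW1 : ENNReal.ofReal r ≤
      wassersteinTwo (ProbabilityTheory.cond ν A) (ProbabilityTheory.cond ν B) :=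
    le_wassersteinTwo hA hB hcA hcB fun x hx y hy => by
      rw [edist_dist]; exact ENNReal.ofReal_le_ofReal (hr x hx y hy)
  have hW2 : wassersteinTwo (ProbabilityTheory.cond ν A) (ProbabilityTheory.cond ν B) < ⊤ :=
    wassersteinTwo_lt_top hcA hcB (D := ENNReal.ofReal (R + R)) ENNReal.ofReal_ne_top
      fun x hx y hy => by
        rw [edist_dist]
        refine ENNReal.ofReal_le_ofReal ((dist_triangle_right x y x₀).trans ?_)
        exact add_le_add (hAR hx) (hBR hy)
  set W := (wassersteinTwo (ProbabilityTheory.cond ν A) (ProbabilityTheory.cond ν B)).toReal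
  have hW : r ≤ W := by
    have := ENNReal.toReal_mono hW2.ne hW1
    rwa [ENNReal.toReal_ofReal hr0.le] at this
  have hW' : r ^ 2 ≤ W ^ 2 := pow_le_pow_left₀ hr0.le hW 2
  have := mul_le_mul_of_nonneg_left hW' hK.le
  linarith

/-- The transport inequality between separated sets, in terms of their masses. -/
theorem IsTameReference.mul_sq_le {M : Type*} [MetricSpace M] [MeasurableSpace M]
    [OpensMeasurableSpace M]
    {ω : Measure M} [SigmaFinite ω] {φ : ℝ → ℝ} {δ θ : ℝ} {Ψ : M → ℝ}
    (h : IsTameReference ω φ δ θ Ψ) {K : ℝ} (hK : 0 < K)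
    (hHess : HessEntropyGE ω φ Ψ K) {q : M → ℝ} (hq : Integrable q ω)
    (hle : ∀ᵐ x ∂ω, refDensity φ Ψ x ^ 2 / φ (refDensity φ Ψ x) ≤ q x)
    {S β : ℝ} (hβ : 0 < β)
    (hS : ∀ E, MeasurableSet E → ∫ x in E, q x ∂ω ≤ S * (refMeasure ω φ Ψ).real E ^ β)
    {A B : Set M} (hA : MeasurableSet A) (hB : MeasurableSet B)
    (hA0 : refMeasure ω φ Ψ A ≠ 0) (hB0 : refMeasure ω φ Ψ B ≠ 0)
    {r : ℝ} (hr0 : 0 < r) (hr : ∀ x ∈ A, ∀ y ∈ B, r ≤ dist x y) {a b : ℝ}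
    (ha : a = (refMeasure ω φ Ψ).real A) (hb : b = (refMeasure ω φ Ψ).real B) :
    K / 4 * r ^ 2 ≤ S *
      ((a ^ β * powerBregman δ a⁻¹ + (1 - a) ^ β * (1 / (2 - θ)))
        + (b ^ β * powerBregman δ b⁻¹ + (1 - b) ^ β * (1 / (2 - θ)))) := by
  have := h.isProbabilityMeasure
  have hδθ := h.tame.growth.lower_le_upper h.tame.isDeformation
  have hθ := h.tame.upper_lt
  set ν := refMeasure ω φ Ψ
  -- Conditionings to unbounded sets may have infinite second moment, so both sets are cut with
  -- balls of radius R about `x₀`.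
  obtain ⟨x₀, -⟩ : A.Nonempty := nonempty_of_measure_ne_zero hA0
  have hlim : ∀ {E : Set M}, Tendsto (fun R : ℕ => ν (E ∩ Metric.closedBall x₀ R)) atTop
      (𝓝 (ν E)) := fun {E} => by
    have hmono : Monotone fun R : ℕ => E ∩ Metric.closedBall x₀ (R : ℝ) := fun i j hij =>
      inter_subset_inter_right _ (Metric.closedBall_subset_closedBall (Nat.cast_le.2 hij))
    have := tendsto_measure_iUnion_atTop (μ := ν) hmono
    rwa [← inter_iUnion, Metric.iUnion_closedBall_nat, inter_univ] at this
  have hlimr : ∀ {E : Set M}, Tendsto (fun R : ℕ => ν.real (E ∩ Metric.closedBall x₀ R)) atTop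
      (𝓝 (ν.real E)) := fun {E} => (ENNReal.tendsto_toReal (measure_ne_top ν E)).comp hlim
  set F : ℝ → ℝ := fun t => t ^ β * powerBregman δ t⁻¹ + (1 - t) ^ β * (1 / (2 - θ)) with hF
  have hFc : ∀ t, 0 < t → ContinuousAt F t := fun t ht => by
    have h1 : ContinuousAt (fun t : ℝ => t ^ β) t := Real.continuousAt_rpow_const _ _ (Or.inr hβ.le)
    have h2 : ContinuousAt (fun t : ℝ => powerBregman δ t⁻¹) t :=
      (continuous_powerBregman (by linarith)).continuousAt.comp (continuousAt_inv₀ ht.ne')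
    have h3 : Continuous fun t : ℝ => (1 - t) ^ β :=
      (Real.continuous_rpow_const hβ.le).comp (continuous_const.sub continuous_id)
    exact (h1.mul h2).add (h3.continuousAt.mul continuousAt_const)
  have hapos : 0 < a := ha ▸ ENNReal.toReal_pos hA0 (measure_ne_top _ _)
  have hbpos : 0 < b := hb ▸ ENNReal.toReal_pos hB0 (measure_ne_top _ _)
  have hAlim : Tendsto (fun R : ℕ => F (ν.real (A ∩ Metric.closedBall x₀ R))) atTop (𝓝 (F a)) :=
    (hFc a hapos).tendsto.comp (ha ▸ hlimr)
  have hBlim : Tendsto (fun R : ℕ => F (ν.real (B ∩ Metric.closedBall x₀ R))) atTop (𝓝 (F b)) :=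
    (hFc b hbpos).tendsto.comp (hb ▸ hlimr)
  -- The truncated bound depends only on masses, and is continuous at positive masses, so R → ∞ is
  -- harmless.
  refine ge_of_tendsto ((hAlim.add hBlim).const_mul S) ?_
  have hterm : ∀ E, MeasurableSet E → ν E ≠ 0 →
      (∫ x in E, q x ∂ω) * powerBregman δ (ν.real E)⁻¹ + (∫ x in Eᶜ, q x ∂ω) * (1 / (2 - θ))
        ≤ S * F (ν.real E) := fun E hE hE0 => by
    have hpos : 0 < ν.real E := ENNReal.toReal_pos hE0 (measure_ne_top _ _)
    have h1 := mul_le_mul_of_nonneg_right (hS E hE)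
      (powerBregman_nonneg (m := δ) (by linarith) (inv_pos.2 hpos))
    have h2 := mul_le_mul_of_nonneg_right (hS Eᶜ hE.compl)
      (show 0 ≤ 1 / (2 - θ) from one_div_nonneg.2 (by linarith))
    rw [probReal_compl_eq_one_sub hE] at h2
    calc _ ≤ _ := add_le_add h1 h2
      _ = _ := by rw [hF]; ring
  filter_upwards [hlim.eventually_ne hA0, hlim.eventually_ne hB0] with R hRA hRB
  have hmA := hA.inter (Metric.isClosed_closedBall (x := x₀) (ε := (R : ℝ))).measurableSet
  have hmB := hB.inter (Metric.isClosed_closedBall (x := x₀) (ε := (R : ℝ))).measurableSet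
  have := h.mul_sq_le_of_bounded hK hHess hq hle hmA hmB hRA hRB inter_subset_right
    inter_subset_right hr0 fun x hx y hy => hr x hx.1 y hy.1
  have h3 := hterm _ hmA hRA
  have h4 := hterm _ hmB hRB
  rw [mul_add]
  linarith

/-! ### Elementary inequalities -/

/-- Second derivatives compare: x^(-m) = x^(p-m) x^(-p) ≤ c^(p-m) x^(-p) on [1,c]. It trades the
exponent δ for θ, to match the weight t^(2-θ) coming from Hölder. -/
theorem powerBregman_le_rpow_mul {m p c : ℝ} (hp : p < 2) (hmp : m ≤ p) (hc : 1 ≤ c) :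
    powerBregman m c ≤ c ^ (p - m) * powerBregman p c := by
  have hpos : ∀ x ∈ uIcc 1 c, 0 < x := fun x hx => (lt_min one_pos (by linarith)).trans_le hx.1
  have := nonneg_of_second_deriv_nonneg (c := c)
    (F := fun x => c ^ (p - m) * powerBregman p x - powerBregman m x)
    (F₁ := fun x => c ^ (p - m) * powerBregmanDeriv p x - powerBregmanDeriv m x)
    (F₂ := fun x => c ^ (p - m) * x ^ (-p) - x ^ (-m))
    (fun x hx => ((hasDerivAt_powerBregman hp (hpos x hx)).const_mul _).sub
      (hasDerivAt_powerBregman (by linarith) (hpos x hx)))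
    (fun x hx => ((hasDerivAt_powerBregmanDeriv (hpos x hx)).const_mul _).sub
      (hasDerivAt_powerBregmanDeriv (hpos x hx)))
    (fun x hx => by
      have hx0 := hpos x hx
      rw [uIcc_of_le hc] at hx
      have h1 : x ^ (-m) = x ^ (p - m) * x ^ (-p) := by
        rw [← Real.rpow_add hx0]; congr 1; ring
      rw [h1, sub_nonneg]
      gcongr
      exact hx.2)
    (by rw [powerBregman_one hp, powerBregman_one (by linarith)]; simp)
    (by rw [powerBregmanDeriv_one, powerBregmanDeriv_one]; simp)
  linarith

theorem mul_powerBregman_inv {m t : ℝ} (hm : m < 1) (ht : 0 < t) :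
    t * powerBregman m t⁻¹ =
      t ^ (-(1 - m)) / ((1 - m) * (2 - m)) - 1 / (1 - m) + t / (2 - m) := by
  have h1 : 1 - m ≠ 0 := by linarith
  have h2 : 2 - m ≠ 0 := by linarith
  have h3 : t⁻¹ ^ (2 - m) = t⁻¹ * t ^ (-(1 - m)) := by
    rw [Real.inv_rpow ht.le, ← Real.rpow_neg ht.le, ← Real.rpow_neg_one t, ← Real.rpow_add ht]
    congr 1; ring
  rw [powerBregman, if_neg hm.ne, h3]
  field_simp

theorem rpow_mul_powerBregman_inv {m t : ℝ} (hm : 1 < m) (hm2 : m < 2) (ht : 0 < t) :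
    t ^ (2 - m) * powerBregman m t⁻¹ =
      t ^ (-(m - 1)) / (m - 1) - 1 / ((m - 1) * (2 - m)) + t ^ (2 - m) / (2 - m) := by
  have h1 : 1 - m ≠ 0 := by linarith
  have h1' : m - 1 ≠ 0 := by linarith
  have h2 : 2 - m ≠ 0 := by linarith
  have h3 : t ^ (-(m - 1)) = t ^ (2 - m) * t⁻¹ := by
    rw [← Real.rpow_neg_one t, ← Real.rpow_add ht]
    congr 1; ring
  have h5 : 0 < t ^ (2 - m) := Real.rpow_pos_of_pos ht _
  rw [powerBregman, if_neg hm.ne', h3, Real.inv_rpow ht.le, show 1 - m = -(m - 1) by ring]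
  field_simp
  ring

theorem two_rpow_le {p : ℝ} (hp : 0 ≤ p) (hp1 : p ≤ 1) : (2 : ℝ) ^ p ≤ 1 + p := by
  have := rpow_one_add_le_one_add_mul_self (s := 1) (by norm_num) hp hp1
  norm_num at this
  exact this

theorem rpow_neg_le_of_half_le {a p : ℝ} (ha : 1 / 2 ≤ a) (hp : 0 ≤ p) (hp1 : p ≤ 1) :
    a ^ (-p) ≤ 1 + p := by
  refine le_trans ?_ (two_rpow_le hp hp1)
  calc a ^ (-p) ≤ (1 / 2 : ℝ) ^ (-p) :=
        Real.rpow_le_rpow_of_nonpos (by norm_num) ha (by linarith)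
    _ = 2 ^ p := by
        rw [one_div, Real.inv_rpow (by norm_num), Real.rpow_neg (by norm_num), inv_inv]

theorem one_le_rpow_neg {b p : ℝ} (hb : 0 < b) (hb1 : b ≤ 1) (hp : 0 ≤ p) : 1 ≤ b ^ (-p) :=
  Real.one_le_rpow_of_pos_of_le_one_of_nonpos hb hb1 (by linarith)

/-- By concavity the power lies below its tangent at 1/2; the linear terms at a and 1 - a cancel,
leaving 2^p. -/
theorem rpow_add_rpow_one_sub_le {a p : ℝ} (ha : 0 ≤ a) (ha1 : a ≤ 1) (hp : 0 ≤ p) (hp1 : p ≤ 1) :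
    a ^ (1 - p) + (1 - a) ^ (1 - p) ≤ 1 + p := by
  have key : ∀ t : ℝ, 0 ≤ t → 2 ^ (1 - p) * t ^ (1 - p) ≤ 1 + (1 - p) * (2 * t - 1) := by
    intro t ht
    have := rpow_one_add_le_one_add_mul_self (s := 2 * t - 1) (by linarith)
      (p := 1 - p) (by linarith) (by linarith)
    rwa [show 1 + (2 * t - 1) = 2 * t by ring, Real.mul_rpow zero_le_two ht] at this
  have h1 := key a ha
  have h2 := key (1 - a) (by linarith)
  have h3 : 2 ^ (1 - p) * (a ^ (1 - p) + (1 - a) ^ (1 - p)) ≤ 2 := by linarith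
  have h4 : (2 : ℝ) ^ p * 2 ^ (1 - p) = 2 := by
    rw [← Real.rpow_add two_pos]; norm_num
  have h5 : (0 : ℝ) < 2 ^ p := Real.rpow_pos_of_pos two_pos _
  have h6 : a ^ (1 - p) + (1 - a) ^ (1 - p) ≤ 2 ^ p := by
    have h7 := mul_le_mul_of_nonneg_left h3 h5.le
    rw [← mul_assoc, h4] at h7
    linarith
  exact h6.trans (two_rpow_le hp hp1)

/-- The transport cost bound when the upper order is at most one. -/
theorem cost_le_of_lower_lt_one {δ θ a b Q : ℝ} (hδ : 0 < δ) (hδ1 : δ < 1) (hδθ : δ ≤ θ)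
    (hθ : θ ≤ 1) (ha : 1 / 2 ≤ a) (hb : 0 < b)
    (hQ : Q ≤ (a * powerBregman δ a⁻¹ + (1 - a) * (1 / (2 - θ)))
        + (b * powerBregman δ b⁻¹ + (1 - b) * (1 / (2 - θ)))) :
    (1 - δ) * Q ≤ b ^ (-(1 - δ)) / (2 - δ) - 1 + 2 * (1 - δ) / (2 - θ) := by
  have hXa := rpow_neg_le_of_half_le ha (p := 1 - δ) (by linarith) (by linarith)
  rw [mul_powerBregman_inv hδ1 (by linarith), mul_powerBregman_inv hδ1 hb] at hQ
  set X := b ^ (-(1 - δ))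
  set Xa := a ^ (-(1 - δ))
  have h1 : 0 < 1 - δ := by linarith
  have h2 : 0 < 2 - δ := by linarith
  have h3 : 1 / (2 - δ) ≤ 1 / (2 - θ) := one_div_le_one_div_of_le (by linarith) (by linarith)
  have h4 : a / (2 - δ) + b / (2 - δ) ≤ (a + b) * (1 / (2 - θ)) := by
    have := mul_le_mul_of_nonneg_left h3 (show 0 ≤ a + b by linarith)
    calc _ = (a + b) * (1 / (2 - δ)) := by ring
      _ ≤ _ := this
  -- Since a ≥ 1/2, Bernoulli gives Xa ≤ 2 - δ, so the power of a is absorbed by the constant -1/(1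
  -- - δ).
  have h5 : Xa / ((1 - δ) * (2 - δ)) ≤ 1 / (1 - δ) := by
    rw [div_le_div_iff₀ (by positivity) h1]
    nlinarith
  have h6 : Q ≤ X / ((1 - δ) * (2 - δ)) - 1 / (1 - δ) + 2 * (1 / (2 - θ)) := by linarith
  calc (1 - δ) * Q ≤ (1 - δ) * (X / ((1 - δ) * (2 - δ)) - 1 / (1 - δ) + 2 * (1 / (2 - θ))) := by
        gcongr
    _ = _ := by field_simp

/-- As (1-x)/(2-x) decreases, θ can be eliminated in favour of δ. The claim becomes δ (X + 2(1-δ)) ≤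
(2-δ)² X for X = b^(-(1-δ)) ≥ 1. -/
theorem mul_one_add_le_of_upper_lt_one {δ θ a b Q : ℝ} (hδ : 0 < δ) (hδθ : δ ≤ θ)
    (hθ : θ < 1) (ha : 1 / 2 ≤ a) (hb : 0 < b) (hab : a + b ≤ 1)
    (hQ : Q ≤ (a * powerBregman δ a⁻¹ + (1 - a) * (1 / (2 - θ)))
        + (b * powerBregman δ b⁻¹ + (1 - b) * (1 / (2 - θ)))) :
    δ * (1 - θ) / ((1 - δ) * (2 - δ)) * (1 + (1 - δ) * Q) ≤ b ^ (-(1 - δ)) := by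
  have hc := cost_le_of_lower_lt_one hδ (by linarith) hδθ hθ.le ha hb hQ
  have hX1 := one_le_rpow_neg hb (by linarith) (p := 1 - δ) (by linarith)
  set X := b ^ (-(1 - δ))
  have h1 : 0 < 1 - δ := by linarith
  have h2 : 0 < 2 - δ := by linarith
  have h3 : 0 < 2 - θ := by linarith
  have hy : (1 - θ) / (2 - θ) ≤ (1 - δ) / (2 - δ) := by
    rw [div_le_div_iff₀ h3 h2]; nlinarith
  have hC : 0 ≤ δ * (1 - θ) / ((1 - δ) * (2 - δ)) :=
    div_nonneg (mul_nonneg hδ.le (by linarith)) (by positivity)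
  calc _ ≤ δ * (1 - θ) / ((1 - δ) * (2 - δ)) * (X / (2 - δ) + 2 * (1 - δ) / (2 - θ)) := by
        exact mul_le_mul_of_nonneg_left (by linarith) hC
    _ = δ * ((1 - θ) / (1 - δ)) * (X / (2 - δ) ^ 2)
        + 2 * δ / (2 - δ) * ((1 - θ) / (2 - θ)) := by field_simp
    _ ≤ δ * 1 * (X / (2 - δ) ^ 2) + 2 * δ / (2 - δ) * ((1 - δ) / (2 - δ)) := by
        gcongr
        rw [div_le_one h1]; linarith
    _ = δ * (X + 2 * (1 - δ)) / (2 - δ) ^ 2 := by field_simp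
    _ ≤ X := by
        rw [div_le_iff₀ (by positivity)]
        nlinarith [mul_nonneg (mul_nonneg h1.le h1.le) (by linarith : 0 ≤ X),
          mul_nonneg h1.le (by linarith : 0 ≤ X - 1)]

/-- The target is the square of X = b^(-(1-δ)), while the cost is at most linear in X; (X - 1)² ≥ 0
bridges the two. -/
theorem mul_one_add_le_of_upper_eq_one {δ a b Q : ℝ} (hδ : 1 / 2 < δ) (hδ1 : δ < 1)
    (ha : 1 / 2 ≤ a) (hb : 0 < b) (hab : a + b ≤ 1)
    (hQ : Q ≤ (a * powerBregman δ a⁻¹ + (1 - a) * (1 / (2 - 1)))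
        + (b * powerBregman δ b⁻¹ + (1 - b) * (1 / (2 - 1)))) :
    (1 + (3 - 2 * δ - 1) * (-2 / (3 - 2 * δ))) * (1 + (3 - 2 * δ - 1) * Q)
      ≤ b ^ (-(3 - 2 * δ - 1)) := by
  have hc := cost_le_of_lower_lt_one (by linarith) hδ1 hδ1.le le_rfl ha hb hQ
  have hX1 := one_le_rpow_neg hb (by linarith) (p := 1 - δ) (by linarith)
  have hX2 : b ^ (-(3 - 2 * δ - 1)) = (b ^ (-(1 - δ))) ^ 2 := by
    rw [← Real.rpow_natCast, ← Real.rpow_mul hb.le]; congr 1; push_cast; ring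
  rw [hX2]
  set X := b ^ (-(1 - δ))
  obtain ⟨ε, rfl⟩ : ∃ ε, δ = 1 - ε := ⟨1 - δ, by ring⟩
  have hε : 0 < ε := by linarith
  have hε2 : ε < 1 / 2 := by linarith
  have e1 : 1 + (3 - 2 * (1 - ε) - 1) * (-2 / (3 - 2 * (1 - ε))) = (1 - 2 * ε) / (1 + 2 * ε) := by
    have : 3 - 2 * (1 - ε) = 1 + 2 * ε := by ring
    rw [this]; field_simp; ring
  have hc' : ε * Q ≤ X / (1 + ε) - 1 + 2 * ε := by
    have e2 : 2 - (1 - ε) = 1 + ε := by ring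
    rw [e2] at hc
    calc ε * Q = (1 - (1 - ε)) * Q := by ring
      _ ≤ _ := hc
      _ = _ := by ring
  rw [e1, div_mul_eq_mul_div, div_le_iff₀ (by linarith)]
  have h5 : X / (1 + ε) ≤ X := div_le_self (by linarith) (by linarith)
  have h6 : 1 + (3 - 2 * (1 - ε) - 1) * Q ≤ 2 * X - 1 + 4 * ε := by linarith
  calc (1 - 2 * ε) * (1 + (3 - 2 * (1 - ε) - 1) * Q) ≤ (1 - 2 * ε) * (2 * X - 1 + 4 * ε) :=
        mul_le_mul_of_nonneg_left h6 (by linarith)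
    _ ≤ X ^ 2 * (1 + 2 * ε) := by
        nlinarith [sq_nonneg (X - 1), mul_nonneg hε.le (sq_nonneg (X - 1)),
          mul_nonneg hε.le (by linarith : 0 ≤ X - 1), mul_nonneg hε.le hε.le]

/-- Here each bracket is exactly log(1/t), the relative entropy of a conditioning, and log(1/a) ≤
1/a - 1 ≤ 1. -/
theorem le_add_log_of_orders_eq_one {a b Q : ℝ} (ha : 1 / 2 ≤ a) (hb : 0 < b)
    (hQ : Q ≤ (a * powerBregman 1 a⁻¹ + (1 - a) * (1 / (2 - 1)))
        + (b * powerBregman 1 b⁻¹ + (1 - b) * (1 / (2 - 1)))) : -2 + Q ≤ Real.log b⁻¹ := by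
  have h : ∀ t : ℝ, 0 < t → t * powerBregman 1 t⁻¹ = Real.log t⁻¹ - 1 + t := fun t ht => by
    rw [powerBregman, if_pos rfl]; field_simp
  rw [h a (by linarith), h b hb] at hQ
  have h2 : Real.log a⁻¹ ≤ a⁻¹ - 1 := Real.log_le_sub_one_of_pos (by positivity)
  have h3 : a⁻¹ ≤ 2 := by
    rw [inv_le_comm₀ (by linarith) two_pos]; linarith
  linarith

/-- Passing from δ to θ costs the factor Z = b^(-(θ-δ)), valid for both terms because b ≤ a. The
θ-terms are explicit with growing part X = b^(-(θ-1)), and Z X is the target power. -/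
theorem mul_one_add_le_of_one_lt_upper {δ θ a b Q : ℝ} (hθ : 1 < θ)
    (hδ : 3 * (θ - 1) < δ) (hδθ : δ ≤ θ) (hθ2 : θ < 3 / 2) (ha : 1 / 2 ≤ a) (hb : 0 < b)
    (hab : a + b ≤ 1)
    (hQ : Q ≤ (a ^ (2 - θ) * powerBregman δ a⁻¹ + (1 - a) ^ (2 - θ) * (1 / (2 - θ)))
        + (b ^ (2 - θ) * powerBregman δ b⁻¹ + (1 - b) ^ (2 - θ) * (1 / (2 - θ)))) :
    (θ - 1) * (3 - 3 * θ + δ) / (2 * θ - δ - 1)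
        * (1 + (2 * θ - δ - 1) * (2 * ((θ - 1) / ((2 - θ) * (3 * θ - δ - 2)) * Q)))
      ≤ b ^ (-(2 * θ - δ - 1)) := by
  have ha0 : 0 < a := by linarith
  have hba : b ≤ a := by linarith
  have hXa := rpow_neg_le_of_half_le ha (p := θ - 1) (by linarith) (by linarith)
  have hX1 := one_le_rpow_neg hb (by linarith) (p := θ - 1) (by linarith)
  have hZ1 := one_le_rpow_neg hb (by linarith) (p := θ - δ) (by linarith)
  have hsa := rpow_add_rpow_one_sub_le ha0.le (by linarith) (p := θ - 1) (by linarith)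
    (by linarith)
  have hsb := rpow_add_rpow_one_sub_le hb.le (by linarith) (p := θ - 1) (by linarith)
    (by linarith)
  rw [show 1 - (θ - 1) = 2 - θ by ring] at hsa hsb
  have hterm : ∀ t, b ≤ t → t ≤ 1 → t ^ (2 - θ) * powerBregman δ t⁻¹
        + (1 - t) ^ (2 - θ) * (1 / (2 - θ)) ≤
      b ^ (-(θ - δ)) * (t ^ (-(θ - 1)) / (θ - 1) - 1 / ((θ - 1) * (2 - θ))
        + (t ^ (2 - θ) + (1 - t) ^ (2 - θ)) * (1 / (2 - θ))) := by
    intro t hbt ht1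
    have ht : 0 < t := hb.trans_le hbt
    have h1 := powerBregman_le_rpow_mul (p := θ) (m := δ) (c := t⁻¹) (by linarith) hδθ
      ((one_le_inv₀ ht).2 ht1)
    have h2 : t⁻¹ ^ (θ - δ) ≤ b ^ (-(θ - δ)) := by
      rw [Real.rpow_neg hb.le, ← Real.inv_rpow hb.le]
      gcongr
    have h3 : 0 ≤ powerBregman θ t⁻¹ := powerBregman_nonneg (by linarith) (inv_pos.2 ht)
    have h4 := rpow_mul_powerBregman_inv hθ (by linarith) ht
    have h5 : 0 < t ^ (2 - θ) := Real.rpow_pos_of_pos ht _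
    have h6 : 0 ≤ (1 - t) ^ (2 - θ) := Real.rpow_nonneg (by linarith) _
    have h7 : 0 ≤ 1 / (2 - θ) := one_div_nonneg.2 (by linarith)
    calc _ ≤ t ^ (2 - θ) * (b ^ (-(θ - δ)) * powerBregman θ t⁻¹)
          + b ^ (-(θ - δ)) * ((1 - t) ^ (2 - θ) * (1 / (2 - θ))) := by
          refine add_le_add ?_ ?_
          · gcongr
            exact h1.trans (by gcongr)
          · exact le_mul_of_one_le_left (by positivity) hZ1
      _ = b ^ (-(θ - δ)) * (t ^ (2 - θ) * powerBregman θ t⁻¹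
            + (1 - t) ^ (2 - θ) * (1 / (2 - θ))) := by ring
      _ = _ := by rw [h4]; ring
  have hta := hterm a hba (by linarith)
  have htb := hterm b le_rfl (by linarith)
  have hZX : b ^ (-(2 * θ - δ - 1)) = b ^ (-(θ - δ)) * b ^ (-(θ - 1)) := by
    rw [← Real.rpow_add hb]; congr 1; ring
  rw [hZX]
  set Z := b ^ (-(θ - δ))
  set X := b ^ (-(θ - 1))
  set Xa := a ^ (-(θ - 1))
  -- In terms of η = θ - 1 and τ = θ - δ, the hypothesis 3(θ-1) < δ reads 1 - 2η - τ > 0.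
  obtain ⟨η, rfl⟩ : ∃ η, θ = 1 + η := ⟨θ - 1, by ring⟩
  obtain ⟨τ, rfl⟩ : ∃ τ, δ = 1 + η - τ := ⟨1 + η - δ, by ring⟩
  have hη : 0 < η := by linarith
  have hη2 : η < 1 / 2 := by linarith
  have hτ : 0 ≤ τ := by linarith
  have hl : 0 < 1 - 2 * η - τ := by linarith
  rw [show 1 + η - 1 = η by ring] at *
  rw [show 2 - (1 + η) = 1 - η by ring] at *
  rw [show 2 * (1 + η) - (1 + η - τ) - 1 = η + τ by ring,
    show 3 - 3 * (1 + η) + (1 + η - τ) = 1 - 2 * η - τ by ring,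
    show 3 * (1 + η) - (1 + η - τ) - 2 = 2 * η + τ by ring]
  have h1η : 0 < 1 - η := by linarith
  set N := (1 - η) * X + (1 + η) ^ 2 - 2 with hN
  have hN0 : 0 ≤ N := by nlinarith
  have hQ' : Q ≤ Z * (N / (η * (1 - η))) := by
    have h1 : X / η - 1 / (η * (1 - η)) + (b ^ (1 - η) + (1 - b) ^ (1 - η)) * (1 / (1 - η))
        + (Xa / η - 1 / (η * (1 - η)) + (a ^ (1 - η) + (1 - a) ^ (1 - η)) * (1 / (1 - η)))
        ≤ X / η - 1 / (η * (1 - η)) + (1 + η) * (1 / (1 - η))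
        + ((1 + η) / η - 1 / (η * (1 - η)) + (1 + η) * (1 / (1 - η))) := by gcongr
    have h2 : X / η - 1 / (η * (1 - η)) + (1 + η) * (1 / (1 - η))
        + ((1 + η) / η - 1 / (η * (1 - η)) + (1 + η) * (1 / (1 - η))) = N / (η * (1 - η)) := by
      rw [hN]; field_simp; ring
    rw [h2] at h1
    have h3 := mul_le_mul_of_nonneg_left h1 (by linarith : 0 ≤ Z)
    linarith
  -- The right sides of `hk1` and `hk2` are the values of the left sides at τ = 0, where they are
  -- largest.
  have hk1 : η * (1 - 2 * η - τ) / (η + τ) ≤ 1 - 2 * η := by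
    rw [div_le_iff₀ (by linarith)]; nlinarith
  have hk2 : η * (1 - 2 * η - τ) * (2 * (η / ((1 - η) * (2 * η + τ))))
      ≤ η * (1 - 2 * η) / (1 - η) := by
    rw [show η * (1 - 2 * η - τ) * (2 * (η / ((1 - η) * (2 * η + τ))))
      = η * (1 - 2 * η - τ) * (2 * η) / ((1 - η) * (2 * η + τ)) by field_simp,
      div_le_div_iff₀ (by positivity) h1η]
    have : (1 - 2 * η - τ) * (2 * η) ≤ (1 - 2 * η) * (2 * η + τ) := by nlinarith
    have := mul_le_mul_of_nonneg_left this (show 0 ≤ η * (1 - η) by positivity)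
    linarith
  have hk3 : 0 ≤ η * (1 - 2 * η - τ) * (2 * (η / ((1 - η) * (2 * η + τ)))) := by positivity
  calc η * (1 - 2 * η - τ) / (η + τ)
        * (1 + (η + τ) * (2 * (η / ((1 - η) * (2 * η + τ)) * Q)))
      = η * (1 - 2 * η - τ) / (η + τ)
        + η * (1 - 2 * η - τ) * (2 * (η / ((1 - η) * (2 * η + τ)))) * Q := by field_simp
    _ ≤ Z * (1 - 2 * η) + η * (1 - 2 * η) / (1 - η) * (Z * (N / (η * (1 - η)))) := by
        refine add_le_add (hk1.trans (le_mul_of_one_le_left (by linarith) hZ1)) ?_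
        exact (mul_le_mul_of_nonneg_left hQ' hk3).trans
          (mul_le_mul_of_nonneg_right hk2 (by positivity))
    _ = Z * ((1 - 2 * η) * ((1 - η) ^ 2 + N) / (1 - η) ^ 2) := by field_simp
    _ ≤ Z * X := by
        refine mul_le_mul_of_nonneg_left ?_ (by linarith)
        rw [div_le_iff₀ (by positivity), hN]
        have : (1 - η) ^ 2 + ((1 - η) * X + (1 + η) ^ 2 - 2) = 2 * η ^ 2 + (1 - η) * X := by ring
        rw [this]
        nlinarith [mul_nonneg hη.le (by linarith : 0 ≤ X - 1),
          mul_nonneg (mul_nonneg hη.le h1η.le) (by linarith : 0 ≤ X - 1),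
          mul_nonneg hη.le (sq_nonneg (1 - 2 * η)), mul_nonneg hη.le h1η.le]

/-! ### Concentration -/

namespace IsTameDeformation

variable {φ : ℝ → ℝ} {δ θ : ℝ}

/-- Upper growth between s and ξ, then lower growth between 1 and ξ, give φ(s) ≥ (s/ξ)^θ φ(ξ) ≥
(s/ξ)^θ ξ^δ. The second step needs ξ ≥ 1. -/
theorem sq_div_le (h : IsTameDeformation φ δ θ) {s ξ : ℝ} (hs : 0 ≤ s) (hξ : 1 ≤ ξ)
    (hsξ : s ≤ ξ) : s ^ 2 / φ s ≤ ξ ^ (θ - δ) * s ^ (2 - θ) := by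
  have hξ0 : 0 < ξ := by linarith
  rcases hs.eq_or_lt with rfl | hs
  · simp only [ne_eq, OfNat.ofNat_ne_zero, not_false_eq_true, zero_pow, zero_div]
    exact mul_nonneg (Real.rpow_nonneg hξ0.le _) (Real.rpow_nonneg le_rfl _)
  · have h1 := h.growth.le_of_le_one hξ0 (div_pos hs hξ0) ((div_le_one hξ0).2 hsξ)
    rw [div_mul_cancel₀ _ hξ0.ne'] at h1
    have h2 := h.rpow_lower_le hξ
    have h3 : 0 < (s / ξ) ^ θ := Real.rpow_pos_of_pos (div_pos hs hξ0) _
    have h4 : (s / ξ) ^ θ * ξ ^ δ ≤ φ s := (mul_le_mul_of_nonneg_left h2 h3.le).trans h1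
    have h5 : 0 < ξ ^ δ := Real.rpow_pos_of_pos hξ0 _
    have h6 : 0 < s ^ θ := Real.rpow_pos_of_pos hs _
    have h7 : 0 < ξ ^ θ := Real.rpow_pos_of_pos hξ0 _
    calc s ^ 2 / φ s ≤ s ^ 2 / ((s / ξ) ^ θ * ξ ^ δ) := by gcongr
      _ = ξ ^ (θ - δ) * s ^ (2 - θ) := by
        rw [Real.div_rpow hs.le hξ0.le, Real.rpow_sub hξ0, Real.rpow_sub hs, Real.rpow_two]
        field_simp

/-- Making the majorant linear in σ turns its integral into ν-mass, with no finiteness of ω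
required. -/
theorem sq_div_le_of_upper_le_one (h : IsTameDeformation φ δ θ) (hθ : θ ≤ 1) {s ξ : ℝ}
    (hs : 0 ≤ s) (hξ : 1 ≤ ξ) (hsξ : s ≤ ξ) : s ^ 2 / φ s ≤ ξ ^ (1 - δ) * s := by
  refine (h.sq_div_le hs hξ hsξ).trans ?_
  have hξ0 : 0 < ξ := by linarith
  rcases hs.eq_or_lt with rfl | hs
  · rw [Real.zero_rpow (by linarith)]; simp
  have h1 : s ^ (1 - θ) ≤ ξ ^ (1 - θ) := Real.rpow_le_rpow hs.le hsξ (by linarith)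
  calc ξ ^ (θ - δ) * s ^ (2 - θ) = ξ ^ (θ - δ) * (s ^ (1 - θ) * s) := by
        rw [← Real.rpow_add_one hs.ne']; congr 2; ring
    _ ≤ ξ ^ (θ - δ) * (ξ ^ (1 - θ) * s) := by gcongr
    _ = ξ ^ (1 - δ) * s := by
        rw [← mul_assoc, ← Real.rpow_add hξ0]; congr 2; ring

end IsTameDeformation

/-- Hölder's inequality against the constant function. -/
theorem setLIntegral_rpow_le {M : Type*} [MeasurableSpace M] (ω : Measure M) {f : M → ℝ≥0∞}
    (hf : AEMeasurable f ω) {β : ℝ} (hβ : 0 < β) (hβ1 : β < 1) (E : Set M) :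
    ∫⁻ x in E, f x ^ β ∂ω ≤ (∫⁻ x in E, f x ∂ω) ^ β * ω E ^ (1 - β) := by
  have hpq : (1 / β).HolderConjugate (1 / (1 - β)) := by
    rw [Real.holderConjugate_iff]
    refine ⟨(one_lt_div hβ).2 hβ1, ?_⟩
    simp
  have := ENNReal.lintegral_mul_le_Lp_mul_Lq (ω.restrict E) hpq (f := fun x => f x ^ β)
    (g := fun _ => 1) (hf.restrict.pow_const β) aemeasurable_const
  simpa [← ENNReal.rpow_mul, hβ.ne'] using this

namespace IsTameReference

variable {M : Type*} [MeasurableSpace M] {ω : Measure M} {φ : ℝ → ℝ} {δ θ : ℝ} {Ψ : M → ℝ}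

theorem lintegral_ofReal_rpow_le (h : IsTameReference ω φ δ θ Ψ) {β : ℝ}
    (hβ : 0 < β) (hβ1 : β < 1) {E : Set M} (hE : MeasurableSet E) :
    ∫⁻ x in E, ENNReal.ofReal (refDensity φ Ψ x ^ β) ∂ω
      ≤ refMeasure ω φ Ψ E ^ β * ω univ ^ (1 - β) := by
  have h1 := setLIntegral_rpow_le ω
    (h.measurable_refDensity.ennreal_ofReal.aemeasurable) hβ hβ1 E
  have h2 : ∫⁻ x in E, ENNReal.ofReal (refDensity φ Ψ x) ∂ω = refMeasure ω φ Ψ E := by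
    rw [← withDensity_apply _ hE, ← h.refMeasure_eq]
  rw [h2] at h1
  calc _ = ∫⁻ x in E, ENNReal.ofReal (refDensity φ Ψ x) ^ β ∂ω := by
        refine lintegral_congr fun x => ?_
        rw [ENNReal.ofReal_rpow_of_nonneg (refDensity_nonneg φ Ψ x) hβ.le]
    _ ≤ _ := h1
    _ ≤ _ := by
        gcongr
        exact subset_univ E

theorem integrable_rpow (h : IsTameReference ω φ δ θ Ψ) (hω : ω univ < ⊤) {β : ℝ}
    (hβ : 0 < β) (hβ1 : β < 1) : Integrable (fun x => refDensity φ Ψ x ^ β) ω := by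
  have := h.isProbabilityMeasure
  refine ⟨(h.measurable_refDensity.pow_const β).aestronglyMeasurable, ?_⟩
  rw [hasFiniteIntegral_iff_ofReal
    (ae_of_all _ fun x => Real.rpow_nonneg (refDensity_nonneg φ Ψ x) _), ← setLIntegral_univ]
  refine (h.lintegral_ofReal_rpow_le hβ hβ1 MeasurableSet.univ).trans_lt ?_
  exact ENNReal.mul_lt_top (ENNReal.rpow_lt_top_of_nonneg hβ.le (measure_ne_top _ _))
    (ENNReal.rpow_lt_top_of_nonneg (by linarith) hω.ne)

theorem setIntegral_rpow_le (h : IsTameReference ω φ δ θ Ψ) (hω : ω univ < ⊤) {β : ℝ}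
    (hβ : 0 < β) (hβ1 : β < 1) {E : Set M} (hE : MeasurableSet E) :
    ∫ x in E, refDensity φ Ψ x ^ β ∂ω
      ≤ (refMeasure ω φ Ψ).real E ^ β * (ω univ).toReal ^ (1 - β) := by
  have := h.isProbabilityMeasure
  rw [integral_eq_lintegral_of_nonneg_ae
    (ae_of_all _ fun x => Real.rpow_nonneg (refDensity_nonneg φ Ψ x) _)
    (h.measurable_refDensity.pow_const β).aestronglyMeasurable, Measure.real,
    ENNReal.toReal_rpow, ENNReal.toReal_rpow, ← ENNReal.toReal_mul]
  refine ENNReal.toReal_mono ?_ (h.lintegral_ofReal_rpow_le hβ hβ1 hE)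
  exact ENNReal.mul_ne_top (ENNReal.rpow_ne_top_of_nonneg hβ.le (measure_ne_top _ _))
    (ENNReal.rpow_ne_top_of_nonneg (by linarith) hω.ne)

end IsTameReference

/-- `B` is the complement of the thickening. If it is ν-null there is nothing to condition on, but
the bound is then trivial. -/
theorem concentrationFunction_le {M : Type*} [MetricSpace M] [MeasurableSpace M]
    [OpensMeasurableSpace M] {ν : Measure M} [IsProbabilityMeasure ν] {r : ℝ} {Y : ℝ≥0∞}
    (h : ∀ A B : Set M, MeasurableSet A → MeasurableSet B → 1 / 2 ≤ ν.real A → 0 < ν.real B →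
      ν.real A + ν.real B ≤ 1 → (∀ x ∈ A, ∀ y ∈ B, r ≤ dist x y) →
      ENNReal.ofReal (ν.real B) ≤ Y) (hr : 0 < r) :
    concentrationFunction ν r ≤ Y := by
  refine iSup_le fun A => iSup₂_le fun hA hA2 => ?_
  have hT : MeasurableSet (Metric.thickening r A) := Metric.isOpen_thickening.measurableSet
  rw [← prob_compl_eq_one_sub hT, ← ofReal_measureReal]
  rcases (measureReal_nonneg (μ := ν) (s := (Metric.thickening r A)ᶜ)).eq_or_lt with h0 | h0
  · rw [← h0]; simp
  refine h A _ hA hT.compl ?_ h0 ?_ fun x hx y hy => ?_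
  · have := ENNReal.toReal_mono (measure_ne_top ν A) hA2
    simpa [Measure.real] using this
  · rw [probReal_compl_eq_one_sub hT]
    have := measureReal_mono (μ := ν) (Metric.self_subset_thickening hr A)
    linarith
  · by_contra hlt
    exact hy (Metric.mem_thickening_iff.2 ⟨x, hx, by rw [dist_comm]; exact not_le.1 hlt⟩)

theorem mExp_of_pos {m τ : ℝ} (hm : m ≠ 1) (h : 0 < 1 + (m - 1) * τ) :
    mExp m τ = ENNReal.ofReal ((1 + (m - 1) * τ) ^ (1 / (m - 1))) := by
  rw [mExp, if_neg hm, ENNReal.ofReal_rpow_of_pos h]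

/-- Solves C · D ≤ b^(-p) for b; C is the constant in the theorem and D the base of the deformed
exponential. -/
theorem ofReal_le_inv_of_mul_le {b C D p : ℝ} (hb : 0 < b) (hC : 0 < C) (hD : 0 < D) (hp : 0 < p)
    (h : C * D ≤ b ^ (-p)) :
    ENNReal.ofReal b ≤ (ENNReal.ofReal (C ^ (1 / p)) * ENNReal.ofReal (D ^ (1 / p)))⁻¹ := by
  have hCD : 0 < (C * D) ^ (1 / p) := Real.rpow_pos_of_pos (mul_pos hC hD) _
  rw [← ENNReal.ofReal_mul (Real.rpow_nonneg hC.le _), ← Real.mul_rpow hC.le hD.le,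
    ← ENNReal.ofReal_inv_of_pos hCD]
  refine ENNReal.ofReal_le_ofReal ?_
  rw [le_inv_comm₀ hb hCD]
  calc (C * D) ^ (1 / p) ≤ (b ^ (-p)) ^ (1 / p) :=
        Real.rpow_le_rpow (mul_pos hC hD).le h (by positivity)
    _ = b⁻¹ := by
        rw [← Real.rpow_mul hb.le, show -p * (1 / p) = -1 by field_simp, Real.rpow_neg_one]

theorem IsAdmissible.isTameReference {M : Type*} [MeasurableSpace M] [TopologicalSpace M]
    [OpensMeasurableSpace M] {n : ℕ} {ω : Measure M}
    {φ : ℝ → ℝ} {Ψ : M → ℝ} (hadm : IsAdmissible n ω φ Ψ) (hφ : IsDeformation φ)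
    (hΨ : Continuous Ψ) (hν : IsProbabilityMeasure (refMeasure ω φ Ψ)) :
    IsTameReference ω φ (lowerOrder φ).toReal (upperOrder φ).toReal Ψ := by
  have htame : IsTameDeformation φ (lowerOrder φ).toReal (upperOrder φ).toReal := by
    refine ⟨hφ, hasPowerGrowth_orders hφ hadm.upperOrder_lt.ne_top, hadm.normalized, ?_⟩
    have := (ENNReal.toReal_lt_toReal hadm.upperOrder_lt.ne_top
      (ENNReal.div_ne_top (by simp) (by simp))).2 hadm.upperOrder_lt
    simpa using this
  refine ⟨htame, hΨ.measurable, fun x => ?_, hν, hadm.integrable_h, hadm.integrable_log⟩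
  refine lt_of_lt_of_le ?_ htame.phiLogSup_powerDeformation_le
  have := EReal.neg_lt_neg_iff.2 (hadm.potential_gt x)
  simpa using this

theorem ae_refDensity_le {M : Type*} [MeasurableSpace M] {ω : Measure M} {φ : ℝ → ℝ} {Ψ : M → ℝ}
    {ξ : ℝ} (hξ : 0 ≤ ξ) (h : eLpNorm (refDensity φ Ψ) ⊤ ω ≤ ENNReal.ofReal ξ) :
    ∀ᵐ x ∂ω, refDensity φ Ψ x ≤ ξ := by
  rw [eLpNorm_exponent_top] at h
  filter_upwards [ae_le_eLpNormEssSup (f := refDensity φ Ψ) (μ := ω)] with x hx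
  have := hx.trans h
  rw [Real.enorm_of_nonneg (refDensity_nonneg φ Ψ x)] at this
  exact (ENNReal.ofReal_le_ofReal_iff hξ).1 this

namespace IsTameReference

variable {M : Type*} [MetricSpace M] [MeasurableSpace M] [OpensMeasurableSpace M]
  {ω : Measure M} {φ : ℝ → ℝ} {δ θ : ℝ} {Ψ : M → ℝ}

theorem cost_le_of_upper_le_one [SigmaFinite ω] (h : IsTameReference ω φ δ θ Ψ) {K : ℝ}
    (hK : 0 < K) (hHess : HessEntropyGE ω φ Ψ K) {ξ : ℝ} (hξ : 1 ≤ ξ)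
    (hσ : ∀ᵐ x ∂ω, refDensity φ Ψ x ≤ ξ) (hθ : θ ≤ 1) {A B : Set M} (hA : MeasurableSet A)
    (hB : MeasurableSet B) (hA0 : 0 < (refMeasure ω φ Ψ).real A)
    (hB0 : 0 < (refMeasure ω φ Ψ).real B) {r : ℝ} (hr0 : 0 < r)
    (hr : ∀ x ∈ A, ∀ y ∈ B, r ≤ dist x y) {a b : ℝ} (ha : a = (refMeasure ω φ Ψ).real A)
    (hb : b = (refMeasure ω φ Ψ).real B) :
    K / 4 * ξ ^ (δ - 1) * r ^ 2 ≤ (a * powerBregman δ a⁻¹ + (1 - a) * (1 / (2 - θ)))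
        + (b * powerBregman δ b⁻¹ + (1 - b) * (1 / (2 - θ))) := by
  have hξ0 : 0 < ξ := by linarith
  have := h.mul_sq_le hK hHess (q := fun x => ξ ^ (1 - δ) * refDensity φ Ψ x)
    (h.integrable_refDensity.const_mul _)
    (hσ.mono fun x hx => h.tame.sq_div_le_of_upper_le_one hθ (refDensity_nonneg φ Ψ x) hξ hx)
    (S := ξ ^ (1 - δ)) (β := 1) one_pos
    (fun E hE => by rw [integral_const_mul, h.setIntegral_refDensity hE, Real.rpow_one])
    hA hB (ENNReal.toReal_pos_iff.1 hA0).1.ne' (ENNReal.toReal_pos_iff.1 hB0).1.ne' hr0 hr ha hb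
  simp only [Real.rpow_one] at this
  have hS : 0 < ξ ^ (1 - δ) := Real.rpow_pos_of_pos hξ0 _
  have e : ξ ^ (δ - 1) = (ξ ^ (1 - δ))⁻¹ := by rw [← Real.rpow_neg hξ0.le]; congr 1; ring
  rw [e]
  calc _ = (K / 4 * r ^ 2) / ξ ^ (1 - δ) := by field_simp
    _ ≤ _ := (div_le_iff₀' hS).2 this

theorem cost_le_of_one_lt_upper [SigmaFinite ω] (h : IsTameReference ω φ δ θ Ψ) {K : ℝ}
    (hK : 0 < K) (hHess : HessEntropyGE ω φ Ψ K) {ξ : ℝ} (hξ : 1 ≤ ξ)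
    (hσ : ∀ᵐ x ∂ω, refDensity φ Ψ x ≤ ξ) (hθ : 1 < θ) (hω : ω univ < ⊤) {A B : Set M}
    (hA : MeasurableSet A) (hB : MeasurableSet B) (hA0 : 0 < (refMeasure ω φ Ψ).real A)
    (hB0 : 0 < (refMeasure ω φ Ψ).real B) {r : ℝ} (hr0 : 0 < r)
    (hr : ∀ x ∈ A, ∀ y ∈ B, r ≤ dist x y) {a b : ℝ} (ha : a = (refMeasure ω φ Ψ).real A)
    (hb : b = (refMeasure ω φ Ψ).real B) :
    K / 4 * ξ ^ (δ - θ) * (ω univ).toReal ^ (1 - θ) * r ^ 2 ≤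
      (a ^ (2 - θ) * powerBregman δ a⁻¹ + (1 - a) ^ (2 - θ) * (1 / (2 - θ)))
        + (b ^ (2 - θ) * powerBregman δ b⁻¹ + (1 - b) ^ (2 - θ) * (1 / (2 - θ))) := by
  have hξ0 : 0 < ξ := by linarith
  have hθ2 := h.tame.upper_lt
  -- ω[M] > 0 because ν = σω has mass one; a positive ω[M]^(θ-1) is needed for the division below.
  have hω0 : 0 < (ω univ).toReal := by
    refine ENNReal.toReal_pos (fun h0 => ?_) hω.ne
    have h1 := h.isProbabilityMeasure.measure_univ
    rw [refMeasure, Measure.measure_univ_eq_zero.1 h0] at h1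
    simp at h1
  have hS1 : 0 < ξ ^ (θ - δ) := Real.rpow_pos_of_pos hξ0 _
  have hS2 : 0 < (ω univ).toReal ^ (θ - 1) := Real.rpow_pos_of_pos hω0 _
  have := h.mul_sq_le hK hHess (q := fun x => ξ ^ (θ - δ) * refDensity φ Ψ x ^ (2 - θ))
    ((h.integrable_rpow hω (by linarith) (by linarith)).const_mul _)
    (hσ.mono fun x hx => h.tame.sq_div_le (refDensity_nonneg φ Ψ x) hξ hx)
    (S := ξ ^ (θ - δ) * (ω univ).toReal ^ (θ - 1)) (β := 2 - θ) (by linarith)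
    (fun E hE => by
      rw [integral_const_mul, mul_assoc]
      refine mul_le_mul_of_nonneg_left ?_ hS1.le
      have := h.setIntegral_rpow_le hω (β := 2 - θ) (by linarith) (by linarith) hE
      rwa [show 1 - (2 - θ) = θ - 1 by ring, mul_comm] at this)
    hA hB (ENNReal.toReal_pos_iff.1 hA0).1.ne' (ENNReal.toReal_pos_iff.1 hB0).1.ne' hr0 hr ha hb
  have e1 : ξ ^ (δ - θ) = (ξ ^ (θ - δ))⁻¹ := by rw [← Real.rpow_neg hξ0.le]; congr 1; ring
  have e2 : (ω univ).toReal ^ (1 - θ) = ((ω univ).toReal ^ (θ - 1))⁻¹ := by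
    rw [← Real.rpow_neg hω0.le]; congr 1; ring
  rw [e1, e2]
  calc _ = (K / 4 * r ^ 2) / (ξ ^ (θ - δ) * (ω univ).toReal ^ (θ - 1)) := by field_simp
    _ ≤ _ := (div_le_iff₀' (mul_pos hS1 hS2)).2 this

end IsTameReference

end

/-! ### The three concentration bounds -/

theorem theorem7p8 {n : ℕ} (hn : 2 ≤ n) {M : Type*} [MetricSpace M]
    [ChartedSpace (EuclideanSpace ℝ (Fin n)) M] [IsManifold (𝓡 n) ((⊤ : ℕ∞) : WithTop ℕ∞) M]
    [Bundle.RiemannianBundle (fun x : M => TangentSpace (𝓡 n) x)]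
    [IsContMDiffRiemannianBundle (𝓡 n) ((⊤ : ℕ∞) : WithTop ℕ∞) (EuclideanSpace ℝ (Fin n))
      (fun x : M => TangentSpace (𝓡 n) x)]
    [IsRiemannianManifold (𝓡 n) M] [CompleteSpace M] [ConnectedSpace M]
    [SecondCountableTopology M] [MeasurableSpace M] [BorelSpace M]
    (f : M → ℝ) (hf : ContMDiff (𝓡 n) 𝓘(ℝ, ℝ) ((⊤ : ℕ∞) : WithTop ℕ∞) f)
    (ω : Measure M) (hω : ω = weightedVolume n f)
    (φ : ℝ → ℝ) (hφ : IsDeformation φ)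
    (Ψ : M → ℝ) (hΨ : Continuous Ψ)
    (hadm : IsAdmissible n ω φ Ψ)
    (ν : Measure M) (hν : ν = refMeasure ω φ Ψ) (hνprob : IsProbabilityMeasure ν)
    (K : ℝ) (hK : 0 < K) (hHess : HessEntropyGE ω φ Ψ K)
    (hσ : eLpNorm (refDensity φ Ψ) ⊤ ω < ⊤)
    (ξ₀ : ℝ) (hξ₀ : max 1 (eLpNorm (refDensity φ Ψ) ⊤ ω) ≤ ENNReal.ofReal ξ₀)
    (θ δ : ℝ) (hθ : θ = (upperOrder φ).toReal) (hδ : δ = (lowerOrder φ).toReal) :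
    (θ < 1 → 0 < δ → ∀ r : ℝ, 0 < r →
      ENNReal.ofReal ((δ * (1 - θ) / ((1 - δ) * (2 - δ))) ^ (1 / (1 - δ)))
          * mExp (2 - δ) (K / 4 * ξ₀ ^ (δ - 1) * r ^ 2)
        ≤ (concentrationFunction ν r)⁻¹) ∧
    (1 < θ → θ < 3 / 2 → 3 * (θ - 1) < δ → ω univ < ⊤ → ∀ r : ℝ, 0 < r →
      concentrationFunction ν r ≤
        ENNReal.ofReal
            (((θ - 1) * (3 - 3 * θ + δ) / (2 * θ - δ - 1)) ^ (1 / (1 - 2 * θ + δ)))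
          * mExp (2 * (1 - θ) + δ)
              (-(K / 2) * ((θ - 1) / ((2 - θ) * (3 * θ - δ - 2)))
                * ξ₀ ^ (δ - θ) * (ω univ).toReal ^ (1 - θ) * r ^ 2)) ∧
    (θ = 1 → 1 / 2 < δ → ∀ r : ℝ, 0 < r →
      mExp (3 - 2 * δ) (-2 / (3 - 2 * δ)) * mExp (3 - 2 * δ) (K / 4 * ξ₀ ^ (δ - 1) * r ^ 2)
        ≤ (concentrationFunction ν r)⁻¹) := by
  subst hθ hδ hω hν
  have : IsManifold (𝓡 n) 1 M :=
    IsManifold.of_le (n := ((⊤ : ℕ∞) : WithTop ℕ∞)) (by exact_mod_cast le_top)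
  have : IsContinuousRiemannianBundle (EuclideanSpace ℝ (Fin n))
      (fun x : M => TangentSpace (𝓡 n) x) := by
    obtain ⟨g, hg, hinner⟩ := IsContMDiffRiemannianBundle.exists_contMDiff (IB := 𝓡 n)
      (n := ((⊤ : ℕ∞) : WithTop ℕ∞)) (F := EuclideanSpace ℝ (Fin n))
      (E := fun x : M => TangentSpace (𝓡 n) x)
    exact ⟨g, hg.continuous, hinner⟩
  have hsf : SigmaFinite (weightedVolume n f : Measure M) := sigmaFinite_weightedVolume f
  set ω := (weightedVolume n f : Measure M)
  have h := hadm.isTameReference hφ hΨ hνprob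
  have hδθ := h.tame.growth.lower_le_upper hφ
  set θ := (upperOrder φ).toReal
  set δ := (lowerOrder φ).toReal
  have hξ1 : 1 ≤ ξ₀ := by
    have := (le_max_left _ _).trans hξ₀
    rwa [ENNReal.one_le_ofReal] at this
  have hξpos : 0 < ξ₀ := by linarith
  have hσξ := ae_refDensity_le hξpos.le ((le_max_right _ _).trans hξ₀)
  have hQ0 : ∀ r : ℝ, 0 ≤ K / 4 * ξ₀ ^ (δ - 1) * r ^ 2 := fun r => by positivity
  refine ⟨fun hθ1 hδ0 r hr => ?_, fun hθ1 hθ2 hδθ3 hωfin r hr => ?_, fun hθ1 hδ r hr => ?_⟩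
  · rw [ENNReal.le_inv_iff_le_inv]
    refine concentrationFunction_le (fun A B hA hB ha hb hab hdist => ?_) hr
    have hQ := h.cost_le_of_upper_le_one hK hHess hξ1 hσξ hθ1.le hA hB (by linarith) hb hr hdist
      rfl rfl
    have hfin := mul_one_add_le_of_upper_lt_one hδ0 hδθ hθ1 ha hb hab hQ
    have h1 : 0 < 1 - δ := by linarith
    have hD : 0 < 1 + (1 - δ) * (K / 4 * ξ₀ ^ (δ - 1) * r ^ 2) :=
      add_pos_of_pos_of_nonneg one_pos (mul_nonneg h1.le (hQ0 r))
    have e : 2 - δ - 1 = 1 - δ := by ring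
    rw [mExp_of_pos (by linarith) (by rwa [e]), e]
    exact ofReal_le_inv_of_mul_le hb
      (div_pos (mul_pos hδ0 (by linarith)) (mul_pos h1 (by linarith))) hD h1 hfin
  · refine concentrationFunction_le (fun A B hA hB ha hb hab hdist => ?_) hr
    have hQ := h.cost_le_of_one_lt_upper hK hHess hξ1 hσξ hθ1 hωfin hA hB (by linarith) hb hr hdist
      rfl rfl
    have hfin := mul_one_add_le_of_one_lt_upper hθ1 hδθ3 hδθ hθ2 ha hb hab hQ
    have hκ : 0 < 2 * θ - δ - 1 := by linarith
    set Q := K / 4 * ξ₀ ^ (δ - θ) * (ω univ).toReal ^ (1 - θ) * r ^ 2 with hQdef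
    have hQ0' : 0 ≤ Q := by positivity
    have hk : 0 ≤ (θ - 1) / ((2 - θ) * (3 * θ - δ - 2)) :=
      div_nonneg (by linarith) (mul_nonneg (by linarith) (by linarith))
    have hD : 0 < 1 + (2 * θ - δ - 1) * (2 * ((θ - 1) / ((2 - θ) * (3 * θ - δ - 2)) * Q)) :=
      add_pos_of_pos_of_nonneg one_pos (by positivity)
    have hC : 0 < (θ - 1) * (3 - 3 * θ + δ) / (2 * θ - δ - 1) :=
      div_pos (mul_pos (by linarith) (by linarith)) hκ
    -- The deformed exponential has m - 1 = -(2θ - δ - 1) and a negative argument, so the signs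
    -- cancel; K/2 is twice the K/4 inside `Q`.
    have e : 1 + (2 * (1 - θ) + δ - 1) * (-(K / 2) * ((θ - 1) / ((2 - θ) * (3 * θ - δ - 2)))
          * ξ₀ ^ (δ - θ) * (ω univ).toReal ^ (1 - θ) * r ^ 2)
        = 1 + (2 * θ - δ - 1) * (2 * ((θ - 1) / ((2 - θ) * (3 * θ - δ - 2)) * Q)) := by
      rw [hQdef]; ring
    rw [mExp_of_pos (by linarith) (by rwa [e]), e]
    -- Both outer exponents are -1/(2θ - δ - 1), so the right side is an inverse, as in the other
    -- cases.
    have e2 : ∀ x : ℝ, 0 < x → ∀ p : ℝ, p = -(2 * θ - δ - 1) →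
        ENNReal.ofReal (x ^ (1 / p)) = (ENNReal.ofReal (x ^ (1 / (2 * θ - δ - 1))))⁻¹ := by
      rintro x hx p rfl
      rw [← ENNReal.ofReal_inv_of_pos (Real.rpow_pos_of_pos hx _), ← Real.rpow_neg hx.le,
        one_div_neg_eq_neg_one_div]
    rw [e2 _ hC _ (by ring), e2 _ hD _ (by ring),
      ← ENNReal.mul_inv (Or.inr ENNReal.ofReal_ne_top) (Or.inl ENNReal.ofReal_ne_top)]
    exact ofReal_le_inv_of_mul_le hb hC hD hκ hfin
  · rw [ENNReal.le_inv_iff_le_inv]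
    refine concentrationFunction_le (fun A B hA hB ha hb hab hdist => ?_) hr
    have hQ := h.cost_le_of_upper_le_one hK hHess hξ1 hσξ hθ1.le hA hB (by linarith) hb hr hdist
      rfl rfl
    rw [hθ1] at hQ hδθ
    -- For δ = 1 the index 3 - 2δ equals 1 and the deformed exponential is `exp`, so a logarithmic
    -- estimate replaces the power one.
    rcases hδθ.lt_or_eq with hδ1 | hδ1
    · have hfin := mul_one_add_le_of_upper_eq_one hδ hδ1 ha hb hab hQ
      have h1 : 0 < 3 - 2 * δ - 1 := by linarith
      have hD : 0 < 1 + (3 - 2 * δ - 1) * (K / 4 * ξ₀ ^ (δ - 1) * r ^ 2) :=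
        add_pos_of_pos_of_nonneg one_pos (mul_nonneg h1.le (hQ0 r))
      -- Positivity of the base is where δ > 1/2 enters: it equals (2δ - 1)/(3 - 2δ).
      have hC : 0 < 1 + (3 - 2 * δ - 1) * (-2 / (3 - 2 * δ)) := by
        have h3 : 0 < 3 - 2 * δ := by linarith
        rw [show 1 + (3 - 2 * δ - 1) * (-2 / (3 - 2 * δ)) = (2 * δ - 1) / (3 - 2 * δ) by
          field_simp; ring]
        exact div_pos (by linarith) h3
      rw [mExp_of_pos (by linarith) hC, mExp_of_pos (by linarith) hD]
      exact ofReal_le_inv_of_mul_le hb hC hD h1 hfin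
    · rw [hδ1] at hQ ⊢
      have hfin := le_add_log_of_orders_eq_one ha hb hQ
      have e : (3 : ℝ) - 2 * 1 = 1 := by norm_num
      rw [e, mExp, if_pos rfl, mExp, if_pos rfl, ← ENNReal.ofReal_mul (Real.exp_pos _).le,
        ← Real.exp_add, ← ENNReal.ofReal_inv_of_pos (Real.exp_pos _)]
      refine ENNReal.ofReal_le_ofReal ?_
      rw [le_inv_comm₀ hb (Real.exp_pos _), ← Real.le_log_iff_exp_le (inv_pos.2 hb), div_one]
      exact hfin
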